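/- **Setting.** Let $K$ be a field of characteristic $0$ and $I$ a finite set. For a polyhedron $p\subseteq\mathbb{R}I$ and a direction $y\in\mathbb{R}^I$, let $p_y$ be the set of points of $p$ at which $y$ attains its maximum over $p$. The nonempty faces of $p$ are the nonempty sets $p_y$; write $q\le p$ when $q$ is a nonempty face of $p$. The normal fan $\mathcal N_p$ is the set of the cones $\mathcal N_p(q)=\{y : q \text{ is a face of } p_y\}$ for $q\le p$. The braid fan is the fan of faces of the arrangement of the hyperplanes $y(i)=y(j)$, $i\ne j$, in $\mathbb{R}^I$. A *generalized permutahedron* in $\mathbb{R}I$ is a nonempty polyhedron whose normal fan is a coarsening of the braid fan (it is then bounded); an *extended generalized permutahedron* is a nonempty, possibly unbounded polyhedron whose normal fan is a coarsening of a subfan of the braid fan. (A coarsening has the same support, and each cone of the finer fan lies in a cone of the coarser one.) Let $\mathrm{GP}[I]$ and $\mathrm{GP}_+[I]$ be the sets of these polyhedra and $\mathbf{GP}[I]$, $\mathbf{GP}_+[I]$ the $K$-vector spaces with these bases. They form Hopf monoids: for a decomposition $I=S\sqcup T$ the product is $\mu_{S,T}(p\otimes q)=p\times q$, and the coproduct is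 $\Delta_{S,T}(p)=p|_S\otimes p/_S$, where $p_{\mathbb 1_S}=p|_S\times p/_S$ is the factorization of the maximum face in the direction $\mathbb 1_S$ into (extended) generalized permutahedra in $\mathbb{R}S$ and $\mathbb{R}T$, if $p$ is bounded above in this direction, and $\Delta_{S,T}(p)=0$ otherwise. The antipode is given by $\mathrm{s}_\emptyset=\mathrm{id}$ and $$\mathrm{s}_I=\sum_{k\ge1}\ \sum_{(S_1,\dots,S_k)\vDash I}(-1)^k\,\mu_{S_1,\dots,S_k}\circ\Delta_{S_1,\dots,S_k}\qquad(I\neq\emptyset),$$ the sum being over all ordered decompositions of $I$ into nonempty parts, with iterated products and coproducts. Two (extended) generalized permutahedra $p,q$ in $\mathbb{R}I$ are *normally equivalent* if $\mathcal N_p=\mathcal N_q$, and *quasinormally equivalent* if $p$ is normally equivalent to $w(q)$ for some permutation $w$ of $I$, acting on $\mathbb{R}I$ by permuting coordinates. A signed sum of basis elements is *cancellation-free* if terms with the same basis element have the same sign, and *grouping-free* if its terms involve distinct basis elements. **Theorem.** In each of the two Hopf monoids $\mathbf{GP}$ and $\mathbf{GP}_+$ the following holds. 1. For every finite set $I$ and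 every basis element $p$ in $\mathbb{R}I$, $$\mathrm{s}_I(p)=(-1)^{|I|}\sum_{q\le p}(-1)^{\dim q}\,q ,$$ where the sum is over all the nonempty faces $q$ of $p$ (which are finitely many and again belong to the basis). This formula is cancellation-free and grouping-free: the coefficient of a basis element $q$ in $\mathrm{s}_I(p)$ is $(-1)^{|I|+\dim q}$ if $q\le p$, and $0$ otherwise. 2. There are unique products and coproducts on the vector spaces spanned by the normal equivalence classes such that the projection $p\mapsto[p]$ preserves products and coproducts. The antipode of this quotient satisfies $$\mathrm{s}_I([p])=(-1)^{|I|}\sum_{q\le p}(-1)^{\dim q}\,[q],$$ and this formula is cancellation-free. 3. The antipode $\mathrm{s}_I$ descends to a unique linear map $\overline{\overline{\mathrm s}}_I$ on the vector space spanned by the quasinormal equivalence classes $[\![p]\!]$ in $\mathbb{R}I$. It satisfies $$\overline{\overline{\mathrm s}}_I([\![p]\!])=(-1)^{|I|}\sum_{q\le p}(-1)^{\dim q}\,[\![q]\!],$$ and this formula is cancellation-free. -/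

import Mathlib

open scoped TensorProduct

noncomputable section

namespace GenPerm

/-! ### Polyhedra, faces and normal fans in `ℝ ι`

A direction `y` acts on a point `x` by `y ⬝ᵥ x = ∑ i, y i * x i`. -/

section Geometry

variable {ι : Type*} [Fintype ι]

/-- A polyhedron: the solution set of finitely many weak linear inequalities. -/
def IsPolyhedron (p : Set (ι → ℝ)) : Prop :=
  ∃ H : Finset ((ι → ℝ) × ℝ), p = {x | ∀ h ∈ H, h.1 ⬝ᵥ x ≤ h.2}

/-- The `y`-maximum face of `p`; it is empty when `y` has no maximum on `p`. -/
def maxFace (p : Set (ι → ℝ)) (y : ι → ℝ) : Set (ι → ℝ) :=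
  {x | x ∈ p ∧ ∀ x' ∈ p, y ⬝ᵥ x' ≤ y ⬝ᵥ x}

/-- `q` is a nonempty face of `p` (the direction `y = 0` gives `p` itself). -/
def IsFace (q p : Set (ι → ℝ)) : Prop :=
  q.Nonempty ∧ ∃ y, q = maxFace p y

/-- The dimension of `q`: the dimension of its affine span. -/
def dim (q : Set (ι → ℝ)) : ℕ := Module.finrank ℝ (vectorSpan ℝ q)

/-- The closed normal cone of `p` at its face `q`. -/
def normalCone (p q : Set (ι → ℝ)) : Set (ι → ℝ) :=
  {y | IsFace q (maxFace p y)}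

/-- The normal fan of `p`: the set of normal cones at the nonempty faces of `p`. -/
def normalFan (p : Set (ι → ℝ)) : Set (Set (ι → ℝ)) :=
  {C | ∃ q, IsFace q p ∧ C = normalCone p q}

/-- The closed face of the braid arrangement `{y i = y j}` that has `y` in its relative interior.
If `S₁, …, S_k` are the level sets of `y`, by decreasing value, it consists of the `z` that are
constant on each `S_a` and satisfy `z i ≥ z j` for `i ∈ S_a`, `j ∈ S_b`, `a < b`. -/
def braidCone (y : ι → ℝ) : Set (ι → ℝ) :=
  {z | ∀ i j, y i ≤ y j → z i ≤ z j}

variable (ι) in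
/-- The fan of all faces of the braid arrangement. -/
def braidFan : Set (Set (ι → ℝ)) := Set.range braidCone

/-- `F` is a subfan of the braid arrangement: a set of its faces that contains, with a cone, all
faces of that cone (among the cones of a fan, these are the cones contained in it). -/
def IsBraidSubfan (F : Set (Set (ι → ℝ))) : Prop :=
  F ⊆ braidFan ι ∧ ∀ C ∈ F, ∀ C' ∈ braidFan ι, C' ⊆ C → C' ∈ F

/-- The fan `G` is a coarsening of the fan `F`: they have the same support, and every cone of `F`
is contained in a cone of `G`. -/
def IsCoarsening (G F : Set (Set (ι → ℝ))) : Prop :=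
  ⋃₀ G = ⋃₀ F ∧ ∀ C ∈ F, ∃ D ∈ G, C ⊆ D

/-- Generalized permutahedra. Their normal fan is complete, so they are bounded. -/
def IsGenPerm (p : Set (ι → ℝ)) : Prop :=
  IsPolyhedron p ∧ p.Nonempty ∧ IsCoarsening (normalFan p) (braidFan ι)

/-- Extended (possibly unbounded) generalized permutahedra. -/
def IsExtGenPerm (p : Set (ι → ℝ)) : Prop :=
  IsPolyhedron p ∧ p.Nonempty ∧ ∃ F, IsBraidSubfan F ∧ IsCoarsening (normalFan p) F

/-- The two settings: bounded, and extended generalized permutahedra. -/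
inductive Kind
  | bounded
  | extended

/-- Generalized permutahedra of the given kind. -/
def IsGP (κ : Kind) (p : Set (ι → ℝ)) : Prop :=
  match κ with
  | .bounded => IsGenPerm p
  | .extended => IsExtGenPerm p

/-- Normal equivalence. -/
def NormallyEquiv (p q : Set (ι → ℝ)) : Prop := normalFan p = normalFan q

/-- The action of a permutation `w` on `ℝ ι`, sending `∑ a i e_i` to `∑ a i e_{w i}`. -/
def permAct (w : Equiv.Perm ι) (x : ι → ℝ) : ι → ℝ := fun i => x (w.symm i)

/-- Quasinormal equivalence: normal equivalence up to the action of a permutation. -/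
def QuasinormallyEquiv (p q : Set (ι → ℝ)) : Prop :=
  ∃ w : Equiv.Perm ι, NormallyEquiv p (permAct w '' q)

/-! Auxiliary facts. -/

lemma mem_braidCone_self (y : ι → ℝ) : y ∈ braidCone y := fun _ _ h => h

lemma braidCone_subset {y z : ι → ℝ} (h : z ∈ braidCone y) : braidCone z ⊆ braidCone y :=
  fun _ hu i j hij => hu i j (h i j hij)

lemma isFace_maxFace_self {p : Set (ι → ℝ)} {y : ι → ℝ} (h : (maxFace p y).Nonempty) :
    IsFace (maxFace p y) (maxFace p y) :=
  ⟨h, 0, by ext x; simp [maxFace]⟩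

lemma maxFace_maxFace {p : Set (ι → ℝ)} {y z : ι → ℝ} (hne : (maxFace p y).Nonempty)
    (h : maxFace p y ⊆ maxFace p z) : maxFace (maxFace p z) y = maxFace p y := by
  obtain ⟨x₀, h₀⟩ := hne
  ext x
  constructor
  · rintro ⟨hx, hmax⟩
    exact ⟨hx.1, fun x' hx' => (h₀.2 x' hx').trans (hmax x₀ (h h₀))⟩
  · intro hx
    exact ⟨h hx, fun x' hx' => hx.2 x' hx'.1⟩

lemma exists_reflect {y z : ι → ℝ} (hz : z ∈ braidCone y) :
    ∃ t : ℝ, 0 < t ∧ y + t • (y - z) ∈ braidCone y := by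
  have key : ∀ ij : ι × ι, ∀ᶠ t : ℝ in nhdsWithin 0 (Set.Ioi 0),
      y ij.1 ≤ y ij.2 → y ij.1 + t * (y ij.1 - z ij.1) ≤ y ij.2 + t * (y ij.2 - z ij.2) := by
    rintro ⟨i, j⟩
    rcases lt_trichotomy (y i) (y j) with h | h | h
    · have hc : Filter.Tendsto (fun t : ℝ => (y j + t * (y j - z j)) - (y i + t * (y i - z i)))
          (nhds 0) (nhds ((y j + 0 * (y j - z j)) - (y i + 0 * (y i - z i)))) := by
        apply Continuous.tendsto
        fun_prop
      have h0 : (0 : ℝ) < (y j + 0 * (y j - z j)) - (y i + 0 * (y i - z i)) := by linarith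
      filter_upwards [(hc.mono_left nhdsWithin_le_nhds).eventually (lt_mem_nhds h0)] with t ht _
      linarith
    · have h1 := hz i j h.le
      have h2 := hz j i h.ge
      have h3 : z i = z j := le_antisymm h1 h2
      filter_upwards with t _
      simp [h, h3]
    · filter_upwards with t ht
      exact absurd ht (not_le.mpr h)
  have hall := (Filter.eventually_all.mpr key).and (self_mem_nhdsWithin (s := Set.Ioi (0 : ℝ)))
  obtain ⟨t, ht, ht0⟩ := hall.exists
  exact ⟨t, ht0, fun i j hij => by simpa using ht (i, j) hij⟩

/-- For an extended generalized permutahedron, the maximum face in the direction of a point of a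
closed braid cone contains the maximum face in the direction of an interior point. -/
lemma IsExtGenPerm.maxFace_subset {p : Set (ι → ℝ)} (hp : IsExtGenPerm p) {y z : ι → ℝ}
    (hz : z ∈ braidCone y) : maxFace p y ⊆ maxFace p z := by
  intro x hx
  obtain ⟨-, -, F, ⟨hF, hface⟩, hsupp, hcont⟩ := hp
  have hy : y ∈ ⋃₀ normalFan p :=
    ⟨_, ⟨maxFace p y, ⟨⟨x, hx⟩, y, rfl⟩, rfl⟩, isFace_maxFace_self ⟨x, hx⟩⟩
  rw [hsupp] at hy
  obtain ⟨C, hC, hyC⟩ := hy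
  obtain ⟨u, rfl⟩ := hF hC
  have hyF := hface _ hC _ ⟨y, rfl⟩ (braidCone_subset hyC)
  obtain ⟨D, ⟨q, -, rfl⟩, hD⟩ := hcont _ hyF
  have hq : ∀ v ∈ braidCone y, q ⊆ maxFace p v := by
    intro v hv
    obtain ⟨-, w, hw⟩ := hD hv
    rw [hw]
    exact fun _ h => h.1
  obtain ⟨x₀, h₀⟩ : q.Nonempty := (hD (mem_braidCone_self y)).1
  obtain ⟨t, ht, hr⟩ := exists_reflect hz
  have e1 := (hq _ hr h₀).2 x hx.1
  have e2 := (hq _ hz h₀).2 x hx.1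
  have e3 := hx.2 x₀ (hq _ hz h₀).1
  simp only [add_dotProduct, smul_dotProduct, sub_dotProduct, smul_eq_mul] at e1
  have e4 : z ⬝ᵥ x₀ ≤ z ⬝ᵥ x := by
    by_contra hlt
    push Not at hlt
    nlinarith
  exact ⟨hx.1, fun x' hx' => ((hq _ hz h₀).2 x' hx').trans e4⟩

lemma isCoarsening_of_maxFace_subset {p : Set (ι → ℝ)}
    (h : ∀ y z, z ∈ braidCone y → maxFace p y ⊆ maxFace p z) :
    IsBraidSubfan {C | ∃ y, (maxFace p y).Nonempty ∧ C = braidCone y} ∧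
    IsCoarsening (normalFan p) {C | ∃ y, (maxFace p y).Nonempty ∧ C = braidCone y} := by
  have hcont : ∀ y, (maxFace p y).Nonempty → braidCone y ⊆ normalCone p (maxFace p y) :=
    fun y hy z hz => ⟨hy, y, (maxFace_maxFace hy (h y z hz)).symm⟩
  refine ⟨⟨?_, ?_⟩, ?_, ?_⟩
  · rintro C ⟨y, -, rfl⟩
    exact ⟨y, rfl⟩
  · rintro C ⟨y, hy, rfl⟩ C' ⟨u, rfl⟩ hsub
    exact ⟨u, hy.mono (h y u (hsub (mem_braidCone_self u))), rfl⟩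
  · apply Set.Subset.antisymm
    · rintro y ⟨C, ⟨q, -, rfl⟩, ⟨x, hx⟩, w, hw⟩
      rw [hw] at hx
      exact ⟨_, ⟨y, ⟨x, hx.1⟩, rfl⟩, mem_braidCone_self y⟩
    · rintro z ⟨C, ⟨y, hy, rfl⟩, hz⟩
      exact ⟨_, ⟨_, ⟨hy, y, rfl⟩, rfl⟩, hcont y hy hz⟩
  · rintro C ⟨y, hy, rfl⟩
    exact ⟨_, ⟨_, ⟨hy, y, rfl⟩, rfl⟩, hcont y hy⟩

lemma isExtGenPerm_iff {p : Set (ι → ℝ)} : IsExtGenPerm p ↔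
    IsPolyhedron p ∧ p.Nonempty ∧ ∀ y z, z ∈ braidCone y → maxFace p y ⊆ maxFace p z :=
  ⟨fun h => ⟨h.1, h.2.1, fun _ _ hz => h.maxFace_subset hz⟩,
    fun h => ⟨h.1, h.2.1, _, isCoarsening_of_maxFace_subset h.2.2⟩⟩

lemma isGenPerm_iff {p : Set (ι → ℝ)} :
    IsGenPerm p ↔ IsExtGenPerm p ∧ ∀ y, (maxFace p y).Nonempty := by
  constructor
  · intro h
    refine ⟨⟨h.1, h.2.1, braidFan ι, ⟨subset_rfl, fun _ _ _ h _ => h⟩, h.2.2⟩, fun y => ?_⟩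
    have hy : y ∈ ⋃₀ braidFan ι := ⟨_, ⟨y, rfl⟩, mem_braidCone_self y⟩
    rw [← h.2.2.1] at hy
    obtain ⟨C, ⟨q, -, rfl⟩, ⟨x, hx⟩, w, hw⟩ := hy
    rw [hw] at hx
    exact ⟨x, hx.1⟩
  · rintro ⟨h, hne⟩
    refine ⟨h.1, h.2.1, ?_⟩
    have := (isCoarsening_of_maxFace_subset fun y z hz => h.maxFace_subset (y := y) hz).2
    convert this using 1
    ext C
    constructor
    · rintro ⟨y, rfl⟩
      exact ⟨y, hne y, rfl⟩
    · rintro ⟨y, -, rfl⟩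
      exact ⟨y, rfl⟩

lemma IsGP.ext {κ : Kind} {p : Set (ι → ℝ)} (h : IsGP κ p) : IsExtGenPerm p := by
  cases κ
  · exact (isGenPerm_iff.mp h).1
  · exact h

/-- An extended generalized permutahedron has finitely many faces. -/
lemma IsExtGenPerm.finite_faces {p : Set (ι → ℝ)} (hp : IsExtGenPerm p) :
    {q | IsFace q p}.Finite := by
  classical
  let rel : (ι → ℝ) → Set (ι × ι) := fun y => {ij | y ij.1 ≤ y ij.2}
  have hrel : ∀ y z, rel y = rel z → maxFace p y ⊆ maxFace p z := by
    intro y z hyz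
    apply hp.maxFace_subset
    intro i j hij
    have : (i, j) ∈ rel y := hij
    rw [hyz] at this
    exact this
  let f : Set (ι × ι) → Set (ι → ℝ) := fun R => ⋃ y ∈ {y | rel y = R}, maxFace p y
  refine (Set.finite_range f).subset ?_
  rintro q ⟨-, y, rfl⟩
  refine ⟨rel y, Set.Subset.antisymm ?_ ?_⟩
  · exact Set.iUnion₂_subset fun z hz => hrel z y hz
  · exact Set.subset_iUnion₂ (s := fun z (_ : z ∈ {z | rel z = rel y}) => maxFace p z) y rfl

lemma permAct_dotProduct (w : Equiv.Perm ι) (x y : ι → ℝ) :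
    permAct w x ⬝ᵥ permAct w y = x ⬝ᵥ y := by
  simp only [dotProduct, permAct]
  exact Equiv.sum_comp w.symm fun i => x i * y i

lemma permAct_permAct (v w : Equiv.Perm ι) (x : ι → ℝ) :
    permAct v (permAct w x) = permAct (v * w) x := by
  ext i
  simp [permAct, Equiv.Perm.mul_def]

lemma permAct_one (x : ι → ℝ) : permAct (1 : Equiv.Perm ι) x = x := rfl

lemma permAct_surj (w : Equiv.Perm ι) (x : ι → ℝ) : ∃ x', permAct w x' = x :=
  ⟨permAct w⁻¹ x, by rw [permAct_permAct, mul_inv_cancel, permAct_one]⟩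

lemma permAct_inj (w : Equiv.Perm ι) : Function.Injective (permAct w) := by
  intro x y h
  have := congrArg (permAct w⁻¹) h
  simpa only [permAct_permAct, inv_mul_cancel, permAct_one] using this

lemma maxFace_perm (w : Equiv.Perm ι) (p : Set (ι → ℝ)) (y : ι → ℝ) :
    maxFace (permAct w '' p) (permAct w y) = permAct w '' maxFace p y := by
  ext x
  constructor
  · rintro ⟨⟨x, hx, rfl⟩, hmax⟩
    refine ⟨x, ⟨hx, fun x' hx' => ?_⟩, rfl⟩
    have := hmax _ ⟨x', hx', rfl⟩
    rwa [permAct_dotProduct, permAct_dotProduct] at this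
  · rintro ⟨x, ⟨hx, hmax⟩, rfl⟩
    refine ⟨⟨x, hx, rfl⟩, ?_⟩
    rintro _ ⟨x', hx', rfl⟩
    rw [permAct_dotProduct, permAct_dotProduct]
    exact hmax x' hx'

lemma IsFace.perm {p q : Set (ι → ℝ)} (h : IsFace q p) (w : Equiv.Perm ι) :
    IsFace (permAct w '' q) (permAct w '' p) := by
  obtain ⟨hne, y, rfl⟩ := h
  exact ⟨hne.image _, permAct w y, (maxFace_perm w p y).symm⟩

lemma image_perm_cancel (w : Equiv.Perm ι) (p : Set (ι → ℝ)) :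
    permAct w⁻¹ '' (permAct w '' p) = p := by
  rw [← Set.image_comp]
  have : permAct w⁻¹ ∘ permAct w = id := by
    funext x
    simp only [Function.comp, permAct_permAct, inv_mul_cancel, permAct_one, id]
  rw [this, Set.image_id]

lemma isFace_perm_iff {p q : Set (ι → ℝ)} (w : Equiv.Perm ι) :
    IsFace (permAct w '' q) (permAct w '' p) ↔ IsFace q p := by
  refine ⟨fun h => ?_, fun h => h.perm w⟩
  have := h.perm w⁻¹
  rwa [image_perm_cancel, image_perm_cancel] at this

lemma normalCone_perm (w : Equiv.Perm ι) (p q : Set (ι → ℝ)) :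
    normalCone (permAct w '' p) (permAct w '' q) = permAct w '' normalCone p q := by
  ext y
  obtain ⟨y, rfl⟩ := permAct_surj w y
  rw [(permAct_inj w).mem_set_image]
  change IsFace _ _ ↔ IsFace _ _
  rw [maxFace_perm, isFace_perm_iff]

lemma normalFan_perm (w : Equiv.Perm ι) (p : Set (ι → ℝ)) :
    normalFan (permAct w '' p) = (permAct w '' ·) '' normalFan p := by
  ext C
  constructor
  · rintro ⟨q, ⟨hne, y, rfl⟩, rfl⟩
    obtain ⟨y, rfl⟩ := permAct_surj w y
    rw [maxFace_perm] at hne ⊢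
    refine ⟨_, ⟨maxFace p y, ⟨?_, y, rfl⟩, rfl⟩, (normalCone_perm w p _).symm⟩
    exact Set.image_nonempty.mp hne
  · rintro ⟨C, ⟨q, hq, rfl⟩, rfl⟩
    exact ⟨_, hq.perm w, (normalCone_perm w p q).symm⟩

lemma NormallyEquiv.perm {p q : Set (ι → ℝ)} (h : NormallyEquiv p q) (w : Equiv.Perm ι) :
    NormallyEquiv (permAct w '' p) (permAct w '' q) := by
  unfold NormallyEquiv at *
  rw [normalFan_perm, normalFan_perm, h]

lemma quasinormallyEquiv_equivalence :
    Equivalence (QuasinormallyEquiv (ι := ι)) where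
  refl p := ⟨1, by
    have : permAct (1 : Equiv.Perm ι) = id := funext permAct_one
    rw [this, Set.image_id]
    rfl⟩
  symm := by
    rintro p q ⟨w, hw⟩
    refine ⟨w⁻¹, ?_⟩
    have := hw.perm w⁻¹
    rw [image_perm_cancel] at this
    exact Eq.symm this
  trans := by
    rintro p q r ⟨v, hv⟩ ⟨w, hw⟩
    refine ⟨v * w, ?_⟩
    have h1 := Eq.trans hv (hw.perm v)
    rw [← Set.image_comp] at h1
    have : permAct v ∘ permAct w = permAct (v * w) := funext (permAct_permAct v w)
    rwa [this] at h1

end Geometry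

/-! ### Operations of Hopf monoids in vector species, and the antipode

A finite set is a `I : Finset α`, and a decomposition `I = S ⊔ T` is a subset `S ⊆ I`
with `T = I \ S`. -/

section Antipode

variable {α : Type*} [DecidableEq α] (K : Type*) [Field K]

/-- The product and coproduct maps of a Hopf monoid in vector species with spaces `H I`. -/
structure Operations (H : Finset α → Type*) [∀ I, AddCommGroup (H I)] [∀ I, Module K (H I)] where
  /-- the product `μ_{S,T} : H[S] ⊗ H[T] → H[I]`, where `T = I \ S` -/
  mul : ∀ {S I : Finset α}, S ⊆ I → (H S ⊗[K] H (I \ S) →ₗ[K] H I)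
  /-- the coproduct `Δ_{S,T} : H[I] → H[S] ⊗ H[T]`, where `T = I \ S` -/
  comul : ∀ {S I : Finset α}, S ⊆ I → (H I →ₗ[K] H S ⊗[K] H (I \ S))

variable {K}
variable {H : Finset α → Type*} [∀ I, AddCommGroup (H I)] [∀ I, Module K (H I)]

/-- The composite `μ_{S₁,…,S_k} ∘ Δ_{S₁,…,S_k}` of the higher coproduct and the higher product,
for a composition `I = S₁ ⊔ ⋯ ⊔ S_k`: the identity for `k = 0` and `k = 1`, and
`μ_{S₁,T} ∘ (id ⊗ μ_{S₂,…,S_k} Δ_{S₂,…,S_k}) ∘ Δ_{S₁,T}` with `T = I \ S₁ = S₂ ⊔ ⋯ ⊔ S_k`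
for `k ≥ 2`. (The value `0` only occurs for lists that are not compositions of `I`.) -/
def Operations.mulComul (X : Operations K H) : List (Finset α) → (I : Finset α) → (H I →ₗ[K] H I)
  | [], _ => LinearMap.id
  | [_], _ => LinearMap.id
  | S :: S' :: L, I =>
      if h : S ⊆ I then
        X.mul h ∘ₗ TensorProduct.map LinearMap.id (X.mulComul (S' :: L) (I \ S)) ∘ₗ X.comul h
      else 0

open Classical in
/-- The compositions of `I` with `k` parts: sequences `(S₁, …, S_k)` of pairwise disjoint nonempty
subsets of `I` with union `I`. -/
def compositions (I : Finset α) (k : ℕ) : Finset (Fin k → Finset α) :=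
  (Fintype.piFinset fun _ : Fin k => I.powerset).filter fun F =>
    (∀ i, (F i).Nonempty) ∧ (∀ i j, i ≠ j → Disjoint (F i) (F j)) ∧ ∀ a ∈ I, ∃ i, a ∈ F i

/-- The antipode, by Takeuchi's formula. For `I = ∅` only the empty composition (`k = 0`)
contributes, which gives the identity; for `I ≠ ∅` there is no composition with `k = 0`. -/
def Operations.antipode (X : Operations K H) (I : Finset α) : H I →ₗ[K] H I :=
  ∑ k ∈ Finset.range (I.card + 1), ∑ F ∈ compositions I k,
    (-1 : K) ^ k • X.mulComul (List.ofFn F) I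

/-- The linear maps `f I` preserve products and coproducts. -/
def IsMorphism {H' : Finset α → Type*} [∀ I, AddCommGroup (H' I)] [∀ I, Module K (H' I)]
    (X : Operations K H) (X' : Operations K H') (f : ∀ I, H I →ₗ[K] H' I) : Prop :=
  ∀ (S I : Finset α) (h : S ⊆ I),
    f I ∘ₗ X.mul h = X'.mul h ∘ₗ TensorProduct.map (f S) (f (I \ S)) ∧
    TensorProduct.map (f S) (f (I \ S)) ∘ₗ X.comul h = X'.comul h ∘ₗ f I

end Antipode

/-! ### The Hopf monoids of generalized permutahedra -/

section HopfGP

variable {α : Type*} [DecidableEq α]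

/-- The (extended) generalized permutahedra in `ℝ I`. -/
def GP (κ : Kind) (I : Finset α) : Type _ := {p : Set (I → ℝ) // IsGP κ p}

/-- The product `p × q ⊆ ℝ I` of `p ⊆ ℝ S` and `q ⊆ ℝ T`, where `I = S ⊔ T`. -/
def prodSet {S I : Finset α} (h : S ⊆ I) (p : Set (S → ℝ)) (q : Set (↥(I \ S) → ℝ)) :
    Set (I → ℝ) :=
  {x | Finset.restrict₂ (π := fun _ => ℝ) h x ∈ p ∧
    Finset.restrict₂ (π := fun _ => ℝ) (Finset.sdiff_subset (s := I) (t := S)) x ∈ q}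

/-- The direction `𝟙_S`. -/
def indicatorDir (S I : Finset α) : I → ℝ := fun i => if (i : α) ∈ S then 1 else 0

section ProductClosed

variable {S I : Finset α} (h : S ⊆ I)

/-- The point of `ℝ I` with the given coordinates in `S` and in `I \ S`. -/
def glue (S I : Finset α) (u : S → ℝ) (v : ↥(I \ S) → ℝ) : I → ℝ :=
  fun i => if hi : (i : α) ∈ S then u ⟨i, hi⟩ else v ⟨i, Finset.mem_sdiff.mpr ⟨i.2, hi⟩⟩

lemma restrict_glue_left (u : S → ℝ) (v : ↥(I \ S) → ℝ) :
    Finset.restrict₂ (π := fun _ => ℝ) h (glue S I u v) = u := by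
  ext i
  simp [Finset.restrict₂, glue]

lemma restrict_glue_right (u : S → ℝ) (v : ↥(I \ S) → ℝ) :
    Finset.restrict₂ (π := fun _ => ℝ) (Finset.sdiff_subset (s := I) (t := S)) (glue S I u v)
      = v := by
  ext i
  have : (i : α) ∉ S := (Finset.mem_sdiff.mp i.2).2
  simp [Finset.restrict₂, glue, this]

lemma sum_split (f : I → ℝ) :
    ∑ i, f i = ∑ i, Finset.restrict₂ (π := fun _ => ℝ) h f i +
      ∑ i, Finset.restrict₂ (π := fun _ => ℝ) (Finset.sdiff_subset (s := I) (t := S)) f i := by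
  let g : α → ℝ := fun a => if ha : a ∈ I then f ⟨a, ha⟩ else 0
  have e1 : ∑ i, f i = ∑ a ∈ I, g a := by
    rw [← Finset.sum_coe_sort I g]
    exact Finset.sum_congr rfl fun i _ => by simp [g]
  have e2 : ∑ i, Finset.restrict₂ (π := fun _ => ℝ) h f i = ∑ a ∈ S, g a := by
    rw [← Finset.sum_coe_sort S g]
    exact Finset.sum_congr rfl fun i _ => by simp [g, Finset.restrict₂, h i.2]
  have e3 : ∑ i, Finset.restrict₂ (π := fun _ => ℝ) (Finset.sdiff_subset (s := I) (t := S)) f i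
      = ∑ a ∈ I \ S, g a := by
    rw [← Finset.sum_coe_sort (I \ S) g]
    refine Finset.sum_congr rfl fun i _ => ?_
    have : (i : α) ∈ I := (Finset.mem_sdiff.mp i.2).1
    simp [g, Finset.restrict₂, this]
  rw [e1, e2, e3, add_comm, Finset.sum_sdiff h]

lemma dotProduct_split (y x : I → ℝ) :
    y ⬝ᵥ x = Finset.restrict₂ (π := fun _ => ℝ) h y ⬝ᵥ Finset.restrict₂ (π := fun _ => ℝ) h x +
      Finset.restrict₂ (π := fun _ => ℝ) (Finset.sdiff_subset (s := I) (t := S)) y ⬝ᵥ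
      Finset.restrict₂ (π := fun _ => ℝ) (Finset.sdiff_subset (s := I) (t := S)) x :=
  sum_split h fun i => y i * x i

lemma maxFace_prodSet {p : Set (S → ℝ)} {q : Set (↥(I \ S) → ℝ)} (y : I → ℝ) :
    maxFace (prodSet h p q) y = prodSet h (maxFace p (Finset.restrict₂ (π := fun _ => ℝ) h y))
      (maxFace q (Finset.restrict₂ (π := fun _ => ℝ) (Finset.sdiff_subset (s := I) (t := S)) y)) := by
  ext x
  constructor
  · rintro ⟨⟨hx1, hx2⟩, hmax⟩
    refine ⟨⟨hx1, fun u hu => ?_⟩, ⟨hx2, fun v hv => ?_⟩⟩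
    · have := hmax (glue S I u (Finset.restrict₂ (π := fun _ => ℝ) Finset.sdiff_subset x))
        ⟨by rwa [restrict_glue_left], by rwa [restrict_glue_right]⟩
      rw [dotProduct_split h y, dotProduct_split h y, restrict_glue_left h,
        restrict_glue_right] at this
      linarith
    · have := hmax (glue S I (Finset.restrict₂ (π := fun _ => ℝ) h x) v)
        ⟨by rwa [restrict_glue_left], by rwa [restrict_glue_right]⟩
      rw [dotProduct_split h y, dotProduct_split h y, restrict_glue_left h,
        restrict_glue_right] at this
      linarith
  · rintro ⟨⟨hx1, hm1⟩, ⟨hx2, hm2⟩⟩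
    refine ⟨⟨hx1, hx2⟩, fun x' hx' => ?_⟩
    rw [dotProduct_split h y, dotProduct_split h y]
    exact add_le_add (hm1 _ hx'.1) (hm2 _ hx'.2)

lemma prodSet_nonempty {p : Set (S → ℝ)} {q : Set (↥(I \ S) → ℝ)} (hp : p.Nonempty)
    (hq : q.Nonempty) : (prodSet h p q).Nonempty := by
  obtain ⟨u, hu⟩ := hp
  obtain ⟨v, hv⟩ := hq
  exact ⟨glue S I u v, by rwa [restrict_glue_left], by rwa [restrict_glue_right]⟩

lemma isPolyhedron_prodSet {p : Set (S → ℝ)} {q : Set (↥(I \ S) → ℝ)} (hp : IsPolyhedron p)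
    (hq : IsPolyhedron q) : IsPolyhedron (prodSet h p q) := by
  classical
  obtain ⟨A, rfl⟩ := hp
  obtain ⟨B, rfl⟩ := hq
  refine ⟨A.image (fun a => (glue S I a.1 0, a.2)) ∪ B.image (fun b => (glue S I 0 b.1, b.2)), ?_⟩
  ext x
  simp only [prodSet, Set.mem_ofPred_eq, Finset.mem_union, Finset.mem_image]
  constructor
  · rintro ⟨h1, h2⟩ _ (⟨a, ha, rfl⟩ | ⟨b, hb, rfl⟩)
    · rw [dotProduct_split h, restrict_glue_left, restrict_glue_right]
      simpa using h1 a ha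
    · rw [dotProduct_split h, restrict_glue_left, restrict_glue_right]
      simpa using h2 b hb
  · intro hx
    refine ⟨fun a ha => ?_, fun b hb => ?_⟩
    · have := hx _ (Or.inl ⟨a, ha, rfl⟩)
      rw [dotProduct_split h, restrict_glue_left, restrict_glue_right] at this
      simpa using this
    · have := hx _ (Or.inr ⟨b, hb, rfl⟩)
      rw [dotProduct_split h, restrict_glue_left, restrict_glue_right] at this
      simpa using this

lemma isExtGenPerm_prodSet {p : Set (S → ℝ)} {q : Set (↥(I \ S) → ℝ)} (hp : IsExtGenPerm p)
    (hq : IsExtGenPerm q) : IsExtGenPerm (prodSet h p q) := by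
  refine isExtGenPerm_iff.mpr ⟨isPolyhedron_prodSet h hp.1 hq.1,
    prodSet_nonempty h hp.2.1 hq.2.1, fun y z hz => ?_⟩
  rw [maxFace_prodSet, maxFace_prodSet]
  rintro x ⟨h1, h2⟩
  exact ⟨hp.maxFace_subset (fun _ _ hij => hz _ _ hij) h1,
    hq.maxFace_subset (fun _ _ hij => hz _ _ hij) h2⟩

lemma isGP_prodSet {κ : Kind} {p : Set (S → ℝ)} {q : Set (↥(I \ S) → ℝ)} (hp : IsGP κ p)
    (hq : IsGP κ q) : IsGP κ (prodSet h p q) := by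
  cases κ
  · have hp' := isGenPerm_iff.mp hp
    have hq' := isGenPerm_iff.mp hq
    refine isGenPerm_iff.mpr ⟨isExtGenPerm_prodSet h hp'.1 hq'.1, fun y => ?_⟩
    rw [maxFace_prodSet]
    exact prodSet_nonempty h (hp'.2 _) (hq'.2 _)
  · exact isExtGenPerm_prodSet h hp hq

end ProductClosed

/-- The product of generalized permutahedra. -/
def GP.prod {κ : Kind} {S I : Finset α} (h : S ⊆ I) (p : GP κ S) (q : GP κ (I \ S)) : GP κ I :=
  ⟨prodSet h p.1 q.1, isGP_prodSet h p.2 q.2⟩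

/-- `(r, c)` is the pair `(p|_S, p/_S)` of the restriction and the contraction of `p`: the maximum
face of `p` in the direction `𝟙_S` is `r × c`. -/
def GP.IsMinors {κ : Kind} {S I : Finset α} (h : S ⊆ I) (p : GP κ I)
    (rc : GP κ S × GP κ (I \ S)) : Prop :=
  maxFace p.1 (indicatorDir S I) = (GP.prod h rc.1 rc.2).1

open Classical in
/-- The coproduct of a generalized permutahedron `p`: it is `p|_S ⊗ p/_S` if `p` is bounded in the
direction `𝟙_S`, and `0` otherwise (the maximum face is then empty, so that it is not a product of
generalized permutahedra, which are nonempty). -/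
def GP.coproduct (K : Type*) [Field K] {κ : Kind} {S I : Finset α} (h : S ⊆ I) (p : GP κ I) :
    (GP κ S →₀ K) ⊗[K] (GP κ (I \ S) →₀ K) :=
  if hp : ∃ rc : GP κ S × GP κ (I \ S), p.IsMinors h rc then
    Finsupp.single hp.choose.1 1 ⊗ₜ[K] Finsupp.single hp.choose.2 1
  else 0

/-- The operations of the Hopf monoid of (extended) generalized permutahedra, on the vector spaces
with basis `GP κ I`. -/
def gpOperations (K : Type*) [Field K] (κ : Kind) :
    Operations K (fun I : Finset α => GP κ I →₀ K) where
  mul h := TensorProduct.lift <|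
    Finsupp.linearCombination K fun p => Finsupp.linearCombination K fun q =>
      Finsupp.single (GP.prod h p q) 1
  comul h := Finsupp.linearCombination K fun p => GP.coproduct K h p

/-- The set of nonempty faces of `p`, as generalized permutahedra. -/
def GP.faces {κ : Kind} {I : Finset α} (p : GP κ I) : Finset (GP κ I) :=
  (Set.Finite.preimage (f := fun q : GP κ I => q.1) Subtype.val_injective.injOn
    p.2.ext.finite_faces).toFinset

/-- The normal equivalence relation on generalized permutahedra. -/
def normalSetoid (κ : Kind) (I : Finset α) : Setoid (GP κ I) where
  r p q := NormallyEquiv p.1 q.1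
  iseqv := ⟨fun _ => rfl, fun h => Eq.symm h, fun h h' => Eq.trans h h'⟩

/-- The quasinormal equivalence relation on generalized permutahedra. -/
def quasinormalSetoid (κ : Kind) (I : Finset α) : Setoid (GP κ I) where
  r p q := QuasinormallyEquiv p.1 q.1
  iseqv := ⟨fun _ => quasinormallyEquiv_equivalence.refl _,
    fun h => quasinormallyEquiv_equivalence.symm h,
    fun h h' => quasinormallyEquiv_equivalence.trans h h'⟩

/-- The projection of the vector space with basis `GP κ I` onto the one whose basis is the set of
equivalence classes. -/
def proj (K : Type*) [Field K] {κ : Kind} {I : Finset α} (s : Setoid (GP κ I)) :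
    (GP κ I →₀ K) →ₗ[K] (Quotient s →₀ K) :=
  Finsupp.lmapDomain K K (Quotient.mk s)

end HopfGP

/-- The signed sum `∑_{t ∈ s} c t • b t`, with signs `c t = ± 1` and members `b t` of a basis, is
cancellation-free: terms with the same basis element have the same sign. -/
def CancellationFree {τ β R : Type*} (s : Finset τ) (c : τ → R) (b : τ → β) : Prop :=
  ∀ t ∈ s, ∀ t' ∈ s, b t = b t' → c t = c t'

/-- The signed sum `∑_{t ∈ s} c t • b t` is grouping-free: its terms belong to distinct elements
`b t` of the basis. -/
def GroupingFree {τ β : Type*} (s : Finset τ) (b : τ → β) : Prop :=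
  ∀ t ∈ s, ∀ t' ∈ s, b t = b t' → t = t'

end GenPerm

end

/-! Compositions `(S₁, …, S_k)` of `I` correspond to the cells of the braid arrangement: a direction
that is constant on each part and decreases from part to part spans a cell of dimension `k`.
Applying `μ ∘ Δ` along the composition to `p` gives the maximum face of `p` in such a direction, or
zero if there is none (`mulComul_single`): maximizing over the parts one after another, in
successive minors, amounts to maximizing in one combined direction.

In Takeuchi's formula a face `q` thus receives the coefficient `∑ (-1)^k` over the cells contained
in `U`, the set of directions whose maximum face is exactly `q`. For a generalized permutahedron `U`
is a union of cells, so this sum is the Euler characteristic with compact support of `U`, computed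
cell by cell. But `U` is itself relatively open and convex, of dimension `|I| - dim q`, so its Euler
characteristic is `(-1)^(|I| - dim q)`. The two counts agree by additivity (`sum_eulerChar_cells`),
which is proved by cutting with one hyperplane at a time and needs only convexity and linear
algebra.

The geometric input is perturbation: for small `ε > 0` the maximum face in the direction `y + ε z`
is the `z`-maximum face of the `y`-maximum face. This follows from Farkas' lemma. It shows that
faces are again generalized permutahedra, that `U` is open in its span, and that this span is the
orthogonal complement of the directions of `q`. A separation argument splits a face on which `𝟙_S`
is constant as a product.

For the quotients, the normal fan carries the same information as the relation "the maximum face at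
`y` is nonempty and contained in the one at `z`" (`normallyEquiv_iff`). This relation is compatible
with faces and products, so the operations descend, and with them the antipode, which is an
expression in them. The relation also determines the dimension, so faces in one class have one sign.
Permutations of coordinates respect faces and dimensions, which settles the quasinormal case. -/

noncomputable section

namespace GenPerm

open Filter Topology

/-! ### Farkas' lemma, perturbed directions, and faces of generalized permutahedra -/

section Perturbation

variable {ι : Type*} [Fintype ι]

/-- Farkas' lemma: a direction that is nonpositive on a polyhedral cone is a nonnegative
combination of the directions that define the cone. -/
lemma exists_nonneg_combination {τ : Type*} (s : Finset τ) (a : τ → ι → ℝ) (z : ι → ℝ)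
    (h : ∀ v, (∀ t ∈ s, a t ⬝ᵥ v ≤ 0) → z ⬝ᵥ v ≤ 0) :
    ∃ c : τ → ℝ, (∀ t, 0 ≤ c t) ∧ z = ∑ t ∈ s, c t • a t := by
  classical
  induction s using Finset.induction_on generalizing a z with
  | empty =>
    refine ⟨0, fun _ => le_rfl, ?_⟩
    have h0 : z ⬝ᵥ z = 0 := le_antisymm (h z (by simp)) (Finset.sum_nonneg fun i _ => mul_self_nonneg _)
    simpa using dotProduct_self_eq_zero.mp h0
  | insert u s hu ih =>
    by_cases hs : ∀ v, (∀ t ∈ s, a t ⬝ᵥ v ≤ 0) → z ⬝ᵥ v ≤ 0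
    · obtain ⟨c, hc, hz⟩ := ih a z hs
      refine ⟨fun t => if t = u then 0 else c t, fun t => ?_, ?_⟩
      · dsimp only
        split_ifs
        exacts [le_rfl, hc t]
      · rw [Finset.sum_insert hu]
        dsimp only
        rw [if_pos rfl, zero_smul, zero_add, hz]
        refine Finset.sum_congr rfl fun t ht => ?_
        rw [if_neg (ne_of_mem_of_not_mem ht hu)]
    · push Not at hs
      obtain ⟨v₀, hv₀, hz₀⟩ := hs
      have hpos : 0 < a u ⬝ᵥ v₀ := by
        by_contra hle
        refine absurd (h v₀ fun t ht => ?_) (not_le.mpr hz₀)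
        rcases Finset.mem_insert.mp ht with rfl | ht
        exacts [not_lt.mp hle, hv₀ t ht]
      set r := a u ⬝ᵥ v₀ with hr
      -- Correcting by multiples of `a u` makes every functional vanish at `v₀`. The corrected
      -- functionals take at `v` the values of the original ones at the projection of `v` along `v₀`
      -- to the hyperplane `a u = 0`, so the hypothesis carries over.
      obtain ⟨c, hc, hz⟩ := ih (fun t => a t - (a t ⬝ᵥ v₀ / r) • a u)
        (z - (z ⬝ᵥ v₀ / r) • a u) (fun v hv => by
          have := h (v - (a u ⬝ᵥ v / r) • v₀) (fun t ht => by
            rcases Finset.mem_insert.mp ht with rfl | ht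
            · rw [dotProduct_sub, dotProduct_smul, smul_eq_mul, ← hr, div_mul_cancel₀ _ hpos.ne',
                sub_self]
            · have := hv t ht
              simp only [sub_dotProduct, smul_dotProduct, smul_eq_mul] at this
              simp only [dotProduct_sub, dotProduct_smul, smul_eq_mul]
              have e : a u ⬝ᵥ v / r * a t ⬝ᵥ v₀ = a t ⬝ᵥ v₀ / r * a u ⬝ᵥ v := by ring
              linarith)
          simp only [sub_dotProduct, smul_dotProduct, smul_eq_mul]
          simp only [dotProduct_sub, dotProduct_smul, smul_eq_mul] at this
          have e : a u ⬝ᵥ v / r * z ⬝ᵥ v₀ = z ⬝ᵥ v₀ / r * a u ⬝ᵥ v := by ring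
          linarith)
      -- The coefficient of `a u` collects all the corrections. It is nonnegative because `v₀` is
      -- positive on `z` and `a u` and nonpositive on the other `a t`.
      refine ⟨fun t => if t = u then z ⬝ᵥ v₀ / r - ∑ t ∈ s, c t * (a t ⬝ᵥ v₀ / r) else c t,
        fun t => ?_, ?_⟩
      · dsimp only
        split_ifs
        · have h1 : ∑ t ∈ s, c t * (a t ⬝ᵥ v₀ / r) ≤ 0 := Finset.sum_nonpos fun t ht =>
            mul_nonpos_of_nonneg_of_nonpos (hc t)
              (div_nonpos_of_nonpos_of_nonneg (hv₀ t ht) hpos.le)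
          have h2 : 0 < z ⬝ᵥ v₀ / r := div_pos hz₀ hpos
          linarith
        · exact hc t
      · have e : ∑ t ∈ s, (if t = u then z ⬝ᵥ v₀ / r - ∑ t ∈ s, c t * (a t ⬝ᵥ v₀ / r) else c t) • a t
            = ∑ t ∈ s, c t • a t := Finset.sum_congr rfl fun t ht => by
          rw [if_neg (ne_of_mem_of_not_mem ht hu)]
        rw [Finset.sum_insert hu]
        dsimp only
        rw [if_pos rfl, e, sub_smul, Finset.sum_smul]
        rw [sub_eq_iff_eq_add] at hz
        refine hz.trans ?_
        simp only [smul_sub, Finset.sum_sub_distrib, smul_smul]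
        abel

/-- A gain in `z` costs a proportional loss in `y`. By Farkas' lemma `z` is `-m y` plus a
nonnegative combination of the constraints tight at `x₀`, and the latter are nonpositive on `x -
x₀`. -/
lemma IsPolyhedron.exists_bound {p : Set (ι → ℝ)} (hp : IsPolyhedron p) {y z x₀ : ι → ℝ}
    (hx₀ : x₀ ∈ maxFace (maxFace p y) z) :
    ∃ m : ℝ, 0 ≤ m ∧ ∀ x ∈ p, z ⬝ᵥ x - z ⬝ᵥ x₀ ≤ m * (y ⬝ᵥ x₀ - y ⬝ᵥ x) := by
  classical
  obtain ⟨⟨hxp, hy⟩, hz⟩ := hx₀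
  obtain ⟨H, rfl⟩ := hp
  let s := H.filter fun h => h.1 ⬝ᵥ x₀ = h.2
  -- The index `none` stands for the inequality `0 ≤ y ⬝ᵥ v`.
  let a : Option ((ι → ℝ) × ℝ) → ι → ℝ := fun o => o.elim (-y) Prod.fst
  obtain ⟨c, hc, hzc⟩ := exists_nonneg_combination (Finset.insertNone s) a z (by
    intro v hv
    have hyv : 0 ≤ y ⬝ᵥ v := by simpa [a] using hv none (by simp)
    have hsv : ∀ h ∈ s, h.1 ⬝ᵥ v ≤ 0 := fun h hh => hv (some h) (by simpa using hh)
    -- A short step from `x₀` along `v` stays in the polyhedron: tight constraints do not grow, and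
    -- slack ones have room.
    have key : ∀ h ∈ H, ∀ᶠ t : ℝ in 𝓝[>] 0, h.1 ⬝ᵥ (x₀ + t • v) ≤ h.2 := by
      intro h hh
      by_cases ht : h.1 ⬝ᵥ x₀ = h.2
      · filter_upwards [self_mem_nhdsWithin] with t ht0
        have h1 := hsv h (Finset.mem_filter.mpr ⟨hh, ht⟩)
        rw [dotProduct_add, dotProduct_smul, smul_eq_mul, ht]
        have := mul_nonpos_of_nonneg_of_nonpos (le_of_lt (Set.mem_Ioi.mp ht0)) h1
        linarith
      · have hlt : h.1 ⬝ᵥ x₀ + 0 * h.1 ⬝ᵥ v < h.2 := by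
          simpa using lt_of_le_of_ne (hxp h hh) ht
        have hcont : Tendsto (fun t : ℝ => h.1 ⬝ᵥ x₀ + t * h.1 ⬝ᵥ v) (𝓝 0)
            (𝓝 (h.1 ⬝ᵥ x₀ + 0 * h.1 ⬝ᵥ v)) := by
          apply Continuous.tendsto
          fun_prop
        filter_upwards [(hcont.mono_left nhdsWithin_le_nhds).eventually (gt_mem_nhds hlt)] with t ht
        rw [dotProduct_add, dotProduct_smul, smul_eq_mul]
        exact ht.le
    obtain ⟨t, ht, ht0⟩ := (((Filter.eventually_all_finset H).mpr key).and
      (self_mem_nhdsWithin (s := Set.Ioi (0 : ℝ)))).exists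
    have ht0 : 0 < t := ht0
    have h1 := hy _ ht
    have h2 : x₀ + t • v ∈ maxFace {x | ∀ h ∈ H, h.1 ⬝ᵥ x ≤ h.2} y := by
      refine ⟨ht, fun x hx => (hy x hx).trans ?_⟩
      rw [dotProduct_add, dotProduct_smul, smul_eq_mul]
      have := mul_nonneg ht0.le hyv
      linarith
    have h3 := hz _ h2
    rw [dotProduct_add, dotProduct_smul, smul_eq_mul] at h3
    by_contra hlt
    have := mul_pos ht0 (not_le.mp hlt)
    linarith)
  refine ⟨c none, hc none, fun x hx => ?_⟩
  have e : z = c none • (-y) + ∑ h ∈ s, c (some h) • h.1 := by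
    rw [hzc, Finset.sum_insertNone]
    rfl
  have h1 : z ⬝ᵥ (x - x₀) =
      c none * (y ⬝ᵥ x₀ - y ⬝ᵥ x) + ∑ h ∈ s, c (some h) * (h.1 ⬝ᵥ x - h.2) := by
    conv_lhs => rw [e]
    rw [add_dotProduct, smul_dotProduct, neg_dotProduct, sum_dotProduct, dotProduct_sub,
      smul_eq_mul, neg_sub]
    congr 1
    refine Finset.sum_congr rfl fun h hh => ?_
    rw [smul_dotProduct, smul_eq_mul, dotProduct_sub, (Finset.mem_filter.mp hh).2]
  have h2 : ∑ h ∈ s, c (some h) * (h.1 ⬝ᵥ x - h.2) ≤ 0 := Finset.sum_nonpos fun h hh =>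
    mul_nonpos_of_nonneg_of_nonpos (hc _)
      (sub_nonpos.mpr (hx h (Finset.mem_filter.mp hh).1))
  rw [dotProduct_sub] at h1
  linarith

/-- The maximum face in a slightly perturbed direction is an iterated maximum face. -/
lemma IsPolyhedron.eventually_maxFace_add_smul {p : Set (ι → ℝ)} (hp : IsPolyhedron p)
    {y z : ι → ℝ} (hne : (maxFace (maxFace p y) z).Nonempty) :
    ∀ᶠ ε : ℝ in 𝓝[>] 0, maxFace p (y + ε • z) = maxFace (maxFace p y) z := by
  obtain ⟨x₀, hx₀⟩ := hne
  obtain ⟨m, hm, hb⟩ := hp.exists_bound hx₀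
  -- Below this bound `ε * m < 1`, also for `m = 0`, so a loss in `y` outweighs the gain in `ε z`
  -- that it allows.
  have hm1 : (0 : ℝ) < 1 / (m + 1) := by positivity
  filter_upwards [Ioo_mem_nhdsGT hm1] with ε hε
  obtain ⟨hε0, hε1⟩ := hε
  have hεm : ε * m < 1 := by
    rw [lt_div_iff₀ (by positivity)] at hε1
    linarith
  have key : ∀ x ∈ p, ε * (z ⬝ᵥ x - z ⬝ᵥ x₀) ≤ ε * m * (y ⬝ᵥ x₀ - y ⬝ᵥ x) := fun x hx => by
    rw [mul_assoc]
    exact mul_le_mul_of_nonneg_left (hb x hx) hε0.le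
  ext x
  constructor
  · rintro ⟨hx, hmax⟩
    have h1 := hmax x₀ hx₀.1.1
    have h2 := key x hx
    have h3 := hx₀.1.2 x hx
    simp only [add_dotProduct, smul_dotProduct, smul_eq_mul] at h1
    have h4 : y ⬝ᵥ x₀ = y ⬝ᵥ x := by nlinarith
    have h5 : z ⬝ᵥ x₀ ≤ z ⬝ᵥ x := by nlinarith
    exact ⟨⟨hx, fun x' hx' => (hx₀.1.2 x' hx').trans h4.le⟩,
      fun x' hx' => (hx₀.2 x' hx').trans h5⟩
  · rintro hx
    refine ⟨hx.1.1, fun x' hx' => ?_⟩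
    have h1 := key x' hx'
    have h2 := hx₀.1.2 x' hx'
    have h3 := hx.1.2 x₀ hx₀.1.1
    have h4 := hx.2 x₀ hx₀.1
    simp only [add_dotProduct, smul_dotProduct, smul_eq_mul]
    nlinarith

lemma isPolyhedron_maxFace {p : Set (ι → ℝ)} (hp : IsPolyhedron p) {y : ι → ℝ}
    (hne : (maxFace p y).Nonempty) : IsPolyhedron (maxFace p y) := by
  classical
  obtain ⟨x₀, hx₀⟩ := hne
  obtain ⟨H, rfl⟩ := hp
  refine ⟨insert (-y, -(y ⬝ᵥ x₀)) H, Set.ext fun x => ?_⟩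
  simp only [Set.mem_ofPred_eq, Finset.forall_mem_insert, neg_dotProduct, neg_le_neg_iff]
  exact ⟨fun hx => ⟨hx.2 x₀ hx₀.1, hx.1⟩, fun hx => ⟨hx.2, fun x' hx' => (hx₀.2 x' hx').trans hx.1⟩⟩

/-- A point outside a nonempty polyhedron is separated from it by a direction that attains its
maximum. -/
lemma IsPolyhedron.exists_separating {p : Set (ι → ℝ)} (hp : IsPolyhedron p) (hne : p.Nonempty)
    {x : ι → ℝ} (hx : x ∉ p) : ∃ y, ∃ x₀ ∈ maxFace p y, y ⬝ᵥ x₀ < y ⬝ᵥ x := by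
  classical
  obtain ⟨H, rfl⟩ := hp
  obtain ⟨u, hu⟩ := hne
  let s := H.filter fun h => h.2 < h.1 ⬝ᵥ x
  -- Walk from `u` towards `x`. The violated constraint `h` is met at the parameter `f h`, and the
  -- first one met, `g`, is maximal over the polyhedron at the exit point.
  have hs : s.Nonempty := by
    simp only [Set.mem_ofPred_eq, not_forall, not_le] at hx
    obtain ⟨h, hh, hlt⟩ := hx
    exact ⟨h, Finset.mem_filter.mpr ⟨hh, hlt⟩⟩
  let f : (ι → ℝ) × ℝ → ℝ := fun h => (h.2 - h.1 ⬝ᵥ u) / (h.1 ⬝ᵥ x - h.1 ⬝ᵥ u)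
  obtain ⟨g, hg, hmin⟩ := s.exists_min_image f hs
  obtain ⟨hgH, hgx⟩ := Finset.mem_filter.mp hg
  have hden : ∀ h ∈ s, 0 < h.1 ⬝ᵥ x - h.1 ⬝ᵥ u := fun h hh => by
    have := hu h (Finset.mem_filter.mp hh).1
    have := (Finset.mem_filter.mp hh).2
    linarith
  have h0 : 0 ≤ f g := div_nonneg (sub_nonneg.mpr (hu g hgH)) (hden g hg).le
  have h1 : f g < 1 := by
    rw [div_lt_one (hden g hg)]
    linarith
  have hval : ∀ h : (ι → ℝ) × ℝ,
      h.1 ⬝ᵥ (u + f g • (x - u)) = h.1 ⬝ᵥ u + f g * (h.1 ⬝ᵥ x - h.1 ⬝ᵥ u) := fun h => by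
    rw [dotProduct_add, dotProduct_smul, dotProduct_sub, smul_eq_mul]
  have hgval : g.1 ⬝ᵥ (u + f g • (x - u)) = g.2 := by
    rw [hval, div_mul_cancel₀ _ (hden g hg).ne']
    ring
  refine ⟨g.1, u + f g • (x - u), ⟨fun h hh => ?_, fun x' hx' => ?_⟩, ?_⟩
  · rw [hval]
    by_cases hs : h.2 < h.1 ⬝ᵥ x
    · have hmem : h ∈ s := Finset.mem_filter.mpr ⟨hh, hs⟩
      have := hmin h hmem
      rw [le_div_iff₀ (hden h hmem)] at this
      linarith
    · have := hu h hh
      nlinarith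
  · rw [hgval]
    exact hx' g hgH
  · rwa [hgval]

/-- For small `ε` the coordinates of `w + ε y` are ordered lexicographically: strict inequalities of
`w` survive by continuity, and `y` breaks the ties. -/
lemma eventually_le_of_add_smul_le (w y : ι → ℝ) : ∀ᶠ ε : ℝ in 𝓝[>] 0, ∀ i j,
    (w + ε • y) i ≤ (w + ε • y) j → w i < w j ∨ w i = w j ∧ y i ≤ y j := by
  refine Filter.eventually_all.mpr fun i => Filter.eventually_all.mpr fun j => ?_
  rcases lt_trichotomy (w i) (w j) with h | h | h
  · exact .of_forall fun _ _ => Or.inl h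
  · filter_upwards [self_mem_nhdsWithin] with ε hε hle
    simp only [Pi.add_apply, Pi.smul_apply, smul_eq_mul, h, add_le_add_iff_left] at hle
    exact Or.inr ⟨h, le_of_mul_le_mul_left hle hε⟩
  · have hc : Tendsto (fun t : ℝ => (w i + t * y i) - (w j + t * y j))
        (𝓝 0) (𝓝 ((w i + 0 * y i) - (w j + 0 * y j))) := by
      apply Continuous.tendsto
      fun_prop
    have h0 : (0 : ℝ) < (w i + 0 * y i) - (w j + 0 * y j) := by linarith
    filter_upwards [(hc.mono_left nhdsWithin_le_nhds).eventually (lt_mem_nhds h0)] with t ht hle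
    simp only [Pi.add_apply, Pi.smul_apply, smul_eq_mul] at hle
    linarith

lemma eventually_mem_braidCone_add_smul (w y : ι → ℝ) :
    ∀ᶠ ε : ℝ in 𝓝[>] 0, w ∈ braidCone (w + ε • y) := by
  filter_upwards [eventually_le_of_add_smul_le w y] with ε h i j hij
  rcases h i j hij with h | h
  exacts [h.le, h.1.le]

lemma eventually_add_smul_mem_braidCone (w : ι → ℝ) {y z : ι → ℝ} (hz : z ∈ braidCone y) :
    ∀ᶠ ε : ℝ in 𝓝[>] 0, w + ε • z ∈ braidCone (w + ε • y) := by
  have hlt : ∀ᶠ ε : ℝ in 𝓝[>] 0, ∀ i j, (w + ε • z) i ≤ (w + ε • z) j ∨ ¬ w i < w j := by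
    have := eventually_le_of_add_smul_le w z
    filter_upwards [this] with ε h i j
    by_contra! hcon
    rcases h j i hcon.1.le with h | h
    · exact absurd h hcon.2.not_gt
    · exact absurd h.1 hcon.2.ne'
  filter_upwards [eventually_le_of_add_smul_le w y, hlt, self_mem_nhdsWithin] with ε h h' hε i j hij
  rcases h i j hij with h | ⟨h, hy⟩
  · exact (h' i j).resolve_right (not_not.mpr h)
  · simp only [Pi.add_apply, Pi.smul_apply, smul_eq_mul, h, add_le_add_iff_left]
    exact mul_le_mul_of_nonneg_left (hz i j hy) (le_of_lt hε)

lemma IsExtGenPerm.maxFace_eq {p : Set (ι → ℝ)} (hp : IsExtGenPerm p) {y z : ι → ℝ}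
    (hz : z ∈ braidCone y) (hy : y ∈ braidCone z) : maxFace p y = maxFace p z :=
  (hp.maxFace_subset hz).antisymm (hp.maxFace_subset hy)

/-- The braid condition covers the case of an empty iterated face too: a maximizer in the perturbed
direction would lie in `maxFace p w` and maximize `y` there. -/
lemma IsExtGenPerm.eventually_maxFace_add_smul {p : Set (ι → ℝ)} (hp : IsExtGenPerm p)
    (w y : ι → ℝ) : ∀ᶠ ε : ℝ in 𝓝[>] 0, maxFace p (w + ε • y) = maxFace (maxFace p w) y := by
  rcases (maxFace (maxFace p w) y).eq_empty_or_nonempty with h | h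
  · filter_upwards [eventually_mem_braidCone_add_smul w y, self_mem_nhdsWithin] with ε hε hpos
    rw [h, Set.eq_empty_iff_forall_notMem]
    intro x hx
    have hxw := hp.maxFace_subset hε hx
    refine Set.eq_empty_iff_forall_notMem.mp h x ⟨hxw, fun x' hx' => ?_⟩
    have h1 := hx.2 x' hx'.1
    have h2 := hx'.2 x hx.1
    have h3 := hxw.2 x' hx'.1
    simp only [add_dotProduct, smul_dotProduct, smul_eq_mul] at h1
    exact le_of_mul_le_mul_left (by linarith : ε * _ ≤ ε * _) hpos
  · exact hp.1.eventually_maxFace_add_smul h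

/-- Maximum faces in directions of nested braid cones are iterated maximum faces. -/
lemma IsExtGenPerm.maxFace_maxFace_of_mem {p : Set (ι → ℝ)} (hp : IsExtGenPerm p) {w y : ι → ℝ}
    (hw : w ∈ braidCone y) : maxFace (maxFace p w) y = maxFace p y := by
  obtain ⟨ε, hε, hpos⟩ := ((hp.eventually_maxFace_add_smul w y).and self_mem_nhdsWithin).exists
  have hpos : 0 < ε := hpos
  rw [← hε]
  -- Since `w` is weakly monotone along `y`, the directions `w + ε y` and `y` order the coordinates
  -- in the same way.
  apply hp.maxFace_eq
  · intro i j hij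
    by_contra hlt
    have h1 := hw j i (not_le.mp hlt).le
    simp only [Pi.add_apply, Pi.smul_apply, smul_eq_mul] at hij
    nlinarith [not_le.mp hlt]
  · intro i j hij
    have := hw i j hij
    simp only [Pi.add_apply, Pi.smul_apply, smul_eq_mul]
    nlinarith

/-- Faces of the face `maxFace p w` are faces of `p` in the directions `w + ε y`, and perturbing by
`ε` respects membership in braid cones. -/
lemma isExtGenPerm_maxFace {p : Set (ι → ℝ)} (hp : IsExtGenPerm p) {w : ι → ℝ}
    (hne : (maxFace p w).Nonempty) : IsExtGenPerm (maxFace p w) := by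
  refine isExtGenPerm_iff.mpr ⟨isPolyhedron_maxFace hp.1 hne, hne, fun y z hz => ?_⟩
  obtain ⟨ε, h1, h2, h3⟩ := ((hp.eventually_maxFace_add_smul w y).and
    ((hp.eventually_maxFace_add_smul w z).and (eventually_add_smul_mem_braidCone w hz))).exists
  rw [← h1, ← h2]
  exact hp.maxFace_subset h3

lemma isGP_maxFace {κ : Kind} {p : Set (ι → ℝ)} (hp : IsGP κ p) {w : ι → ℝ}
    (hne : (maxFace p w).Nonempty) : IsGP κ (maxFace p w) := by
  cases κ
  · have hp' := isGenPerm_iff.mp hp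
    refine isGenPerm_iff.mpr ⟨isExtGenPerm_maxFace hp'.1 hne, fun y => ?_⟩
    obtain ⟨ε, hε⟩ := (hp'.1.eventually_maxFace_add_smul w y).exists
    rw [← hε]
    exact hp'.2 _
  · exact isExtGenPerm_maxFace hp hne

lemma IsGP.nonempty {κ : Kind} {p : Set (ι → ℝ)} (hp : IsGP κ p) : p.Nonempty := hp.ext.2.1

lemma isGP_of_isFace {κ : Kind} {p q : Set (ι → ℝ)} (hp : IsGP κ p) (hq : IsFace q p) :
    IsGP κ q := by
  obtain ⟨hne, y, rfl⟩ := hq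
  exact isGP_maxFace hp hne

/-- The directions that are constant on `p` are those whose maximum face is all of `p`. -/
lemma subset_maxFace_iff {p : Set (ι → ℝ)} {y : ι → ℝ} :
    p ⊆ maxFace p y ↔ ∀ v ∈ vectorSpan ℝ p, y ⬝ᵥ v = 0 := by
  constructor
  · intro h v hv
    induction hv using Submodule.span_induction with
    | mem v hv =>
      obtain ⟨a, ha, b, hb, rfl⟩ := hv
      dsimp only
      rw [vsub_eq_sub, dotProduct_sub, sub_eq_zero]
      exact le_antisymm ((h hb).2 a ha) ((h ha).2 b hb)
    | zero => exact dotProduct_zero y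
    | add v w _ _ hv hw => rw [dotProduct_add, hv, hw, add_zero]
    | smul c v _ hv => rw [dotProduct_smul, hv, smul_zero]
  · intro h x hx
    refine ⟨hx, fun x' hx' => ?_⟩
    have := h _ (vsub_mem_vectorSpan ℝ hx' hx)
    rw [vsub_eq_sub, dotProduct_sub] at this
    linarith

end Perturbation

/-! ### Restriction and contraction; iterated coproducts as maximum faces -/

section Minors

variable {α : Type*} [DecidableEq α]

lemma maxFace_zero {ι : Type*} [Fintype ι] (p : Set (ι → ℝ)) : maxFace p 0 = p := by
  ext x
  simp [maxFace]

lemma maxFace_add_smul_of_subset {ι : Type*} [Fintype ι] {p : Set (ι → ℝ)} {w : ι → ℝ}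
    (hw : p ⊆ maxFace p w) (y : ι → ℝ) (c : ℝ) : maxFace p (y + c • w) = maxFace p y := by
  have key : ∀ x ∈ p, ∀ x' ∈ p, w ⬝ᵥ x = w ⬝ᵥ x' := fun x hx x' hx' =>
    le_antisymm ((hw hx').2 x hx) ((hw hx).2 x' hx')
  ext x
  refine and_congr_right fun hx => forall₂_congr fun x' hx' => ?_
  simp only [add_dotProduct, smul_dotProduct, key x hx x' hx', add_le_add_iff_right]

lemma glue_restrict {S I : Finset α} (h : S ⊆ I) (x : I → ℝ) :
    glue S I (Finset.restrict₂ (π := fun _ => ℝ) h x)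
      (Finset.restrict₂ (π := fun _ => ℝ) (Finset.sdiff_subset (s := I) (t := S)) x) = x := by
  ext i
  simp only [glue, Finset.restrict₂]
  split_ifs <;> rfl

lemma subset_of_prodSet_subset {S I : Finset α} (h : S ⊆ I) {p p' : Set (S → ℝ)}
    {q q' : Set (↥(I \ S) → ℝ)} (hsub : prodSet h p q ⊆ prodSet h p' q') :
    (q.Nonempty → p ⊆ p') ∧ (p.Nonempty → q ⊆ q') := by
  constructor
  · rintro ⟨v, hv⟩ u hu
    have := (hsub (a := glue S I u v) ⟨by rwa [restrict_glue_left], by rwa [restrict_glue_right]⟩).1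
    rwa [restrict_glue_left] at this
  · rintro ⟨u, hu⟩ v hv
    have := (hsub (a := glue S I u v) ⟨by rwa [restrict_glue_left], by rwa [restrict_glue_right]⟩).2
    rwa [restrict_glue_right] at this

lemma prodSet_mono {S I : Finset α} (h : S ⊆ I) {p p' : Set (S → ℝ)}
    {q q' : Set (↥(I \ S) → ℝ)} (hp : p ⊆ p') (hq : q ⊆ q') :
    prodSet h p q ⊆ prodSet h p' q' := fun _ hx => ⟨hp hx.1, hq hx.2⟩

lemma nonempty_of_prodSet_nonempty {S I : Finset α} (h : S ⊆ I) {p : Set (S → ℝ)}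
    {q : Set (↥(I \ S) → ℝ)} (hne : (prodSet h p q).Nonempty) : p.Nonempty ∧ q.Nonempty :=
  ⟨⟨_, hne.some_mem.1⟩, ⟨_, hne.some_mem.2⟩⟩

/-- On a generalized permutahedron on which `𝟙_S` is constant, the coordinates in `S` and outside
of `S` can be compared separately. -/
lemma IsExtGenPerm.maxFace_subset_of_split {S I : Finset α} {f : Set (I → ℝ)}
    (hf : IsExtGenPerm f) (hS : f ⊆ maxFace f (indicatorDir S I)) {y z : I → ℝ}
    (hyz : ∀ i j : I, ((i : α) ∈ S ↔ (j : α) ∈ S) → y i ≤ y j → z i ≤ z j) :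
    maxFace f y ⊆ maxFace f z := by
  -- Adding `M • 𝟙_S` changes no face of `f`, and `M` exceeds the spread of both `y` and `z`, so all
  -- coordinates in `S` come to lie above all the others.
  set M : ℝ := 2 * ‖y‖ + 2 * ‖z‖ + 1 with hM
  rw [← maxFace_add_smul_of_subset hS y M, ← maxFace_add_smul_of_subset hS z M]
  apply hf.maxFace_subset
  intro i j hij
  have b1 := abs_le.mp (norm_le_pi_norm y i)
  have b2 := abs_le.mp (norm_le_pi_norm y j)
  have b3 := abs_le.mp (norm_le_pi_norm z i)
  have b4 := abs_le.mp (norm_le_pi_norm z j)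
  simp only [Pi.add_apply, Pi.smul_apply, indicatorDir, smul_eq_mul, mul_ite, mul_one,
    mul_zero] at hij ⊢
  by_cases hi : (i : α) ∈ S <;> by_cases hj : (j : α) ∈ S <;>
    simp only [hi, hj, if_true, if_false] at hij ⊢
  · have := hyz i j (by simp [hi, hj]) (by linarith)
    linarith
  · linarith
  · linarith
  · have := hyz i j (by simp [hi, hj]) (by linarith)
    linarith

/-- Otherwise some `y`, with maximum at `x₀ ∈ f`, separates the glued point from `f`. The parts of
`y` on `S` and off `S`, extended by zero, are maximal at `x₀` as well; comparing with `x` in the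
first and with `x'` in the second and adding contradicts the separation. -/
lemma IsExtGenPerm.glue_mem {S I : Finset α} (h : S ⊆ I) {f : Set (I → ℝ)}
    (hf : IsExtGenPerm f) (hS : f ⊆ maxFace f (indicatorDir S I)) {x x' : I → ℝ}
    (hx : x ∈ f) (hx' : x' ∈ f) :
    glue S I (Finset.restrict₂ (π := fun _ => ℝ) h x)
      (Finset.restrict₂ (π := fun _ => ℝ) (Finset.sdiff_subset (s := I) (t := S)) x') ∈ f := by
  by_contra hcon
  obtain ⟨y, x₀, hx₀, hlt⟩ := hf.1.exists_separating hf.2.1 hcon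
  have h1 := (hf.maxFace_subset_of_split hS
    (z := glue S I (Finset.restrict₂ (π := fun _ => ℝ) h y) 0) (fun i j hiff hij => by
      simp only [glue, hiff]
      split_ifs
      exacts [hij, le_rfl]) hx₀).2 x hx
  have h2 := (hf.maxFace_subset_of_split hS
    (z := glue S I 0 (Finset.restrict₂ (π := fun _ => ℝ) Finset.sdiff_subset y))
    (fun i j hiff hij => by
      simp only [glue, hiff]
      split_ifs
      exacts [le_rfl, hij]) hx₀).2 x' hx'
  rw [dotProduct_split h, dotProduct_split h, restrict_glue_left, restrict_glue_right,
    zero_dotProduct, zero_dotProduct, add_zero, add_zero] at h1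
  rw [dotProduct_split h, dotProduct_split h, restrict_glue_left, restrict_glue_right,
    zero_dotProduct, zero_dotProduct, zero_add, zero_add] at h2
  rw [dotProduct_split h, dotProduct_split h, restrict_glue_left, restrict_glue_right] at hlt
  linarith

lemma isPolyhedron_left_of_prodSet {S I : Finset α} (h : S ⊆ I) {r : Set (S → ℝ)}
    {c : Set (↥(I \ S) → ℝ)} (hf : IsPolyhedron (prodSet h r c)) (hc : c.Nonempty) :
    IsPolyhedron r := by
  classical
  obtain ⟨H, hH⟩ := hf
  obtain ⟨v, hv⟩ := hc
  refine ⟨H.image fun a => (Finset.restrict₂ (π := fun _ => ℝ) h a.1,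
    a.2 - Finset.restrict₂ (π := fun _ => ℝ) Finset.sdiff_subset a.1 ⬝ᵥ v), ?_⟩
  ext u
  have key : u ∈ r ↔ glue S I u v ∈ prodSet h r c := by
    simp only [prodSet, Set.mem_ofPred_eq, restrict_glue_left, restrict_glue_right, hv, and_true]
  rw [key, hH]
  simp only [Set.mem_ofPred_eq, Finset.forall_mem_image]
  refine forall₂_congr fun a _ => ?_
  rw [dotProduct_split h, restrict_glue_left, restrict_glue_right, le_sub_iff_add_le]

lemma isPolyhedron_right_of_prodSet {S I : Finset α} (h : S ⊆ I) {r : Set (S → ℝ)}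
    {c : Set (↥(I \ S) → ℝ)} (hf : IsPolyhedron (prodSet h r c)) (hr : r.Nonempty) :
    IsPolyhedron c := by
  classical
  obtain ⟨H, hH⟩ := hf
  obtain ⟨u, hu⟩ := hr
  refine ⟨H.image fun a => (Finset.restrict₂ (π := fun _ => ℝ) Finset.sdiff_subset a.1,
    a.2 - Finset.restrict₂ (π := fun _ => ℝ) h a.1 ⬝ᵥ u), ?_⟩
  ext v
  have key : v ∈ c ↔ glue S I u v ∈ prodSet h r c := by
    simp only [prodSet, Set.mem_ofPred_eq, restrict_glue_left, restrict_glue_right, hu, true_and]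
  rw [key, hH]
  simp only [Set.mem_ofPred_eq, Finset.forall_mem_image]
  refine forall₂_congr fun a _ => ?_
  rw [dotProduct_split h, restrict_glue_left, restrict_glue_right, le_sub_iff_add_le']

lemma maxFace_prodSet_glue {S I : Finset α} (h : S ⊆ I) (r : Set (S → ℝ))
    (c : Set (↥(I \ S) → ℝ)) (y : S → ℝ) (z : ↥(I \ S) → ℝ) :
    maxFace (prodSet h r c) (glue S I y z) = prodSet h (maxFace r y) (maxFace c z) := by
  rw [maxFace_prodSet, restrict_glue_left, restrict_glue_right]

/-- A direction of one factor is extended by zero, which selects all of the other factor. Extension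
by zero does not respect braid cones, but the constancy of `𝟙_S` makes comparisons between `S` and
its complement irrelevant. -/
lemma isExtGenPerm_of_prodSet {S I : Finset α} (h : S ⊆ I) {r : Set (S → ℝ)}
    {c : Set (↥(I \ S) → ℝ)} (hf : IsExtGenPerm (prodSet h r c))
    (hS : prodSet h r c ⊆ maxFace (prodSet h r c) (indicatorDir S I)) :
    IsExtGenPerm r ∧ IsExtGenPerm c := by
  obtain ⟨hr, hc⟩ := nonempty_of_prodSet_nonempty h hf.2.1
  refine ⟨isExtGenPerm_iff.mpr ⟨isPolyhedron_left_of_prodSet h hf.1 hc, hr, fun y z hz => ?_⟩,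
    isExtGenPerm_iff.mpr ⟨isPolyhedron_right_of_prodSet h hf.1 hr, hc, fun y z hz => ?_⟩⟩
  · have := hf.maxFace_subset_of_split hS (y := glue S I y 0) (z := glue S I z 0)
      (fun i j hiff hij => by
        simp only [glue, hiff] at hij ⊢
        split_ifs at hij ⊢
        exacts [hz _ _ hij, le_rfl])
    rw [maxFace_prodSet_glue, maxFace_prodSet_glue, maxFace_zero] at this
    exact (subset_of_prodSet_subset h this).1 hc
  · have := hf.maxFace_subset_of_split hS (y := glue S I 0 y) (z := glue S I 0 z)
      (fun i j hiff hij => by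
        simp only [glue, hiff] at hij ⊢
        split_ifs at hij ⊢
        exacts [le_rfl, hz _ _ hij])
    rw [maxFace_prodSet_glue, maxFace_prodSet_glue, maxFace_zero] at this
    exact (subset_of_prodSet_subset h this).2 hr

lemma isGP_of_prodSet {κ : Kind} {S I : Finset α} (h : S ⊆ I) {r : Set (S → ℝ)}
    {c : Set (↥(I \ S) → ℝ)} (hf : IsGP κ (prodSet h r c))
    (hS : prodSet h r c ⊆ maxFace (prodSet h r c) (indicatorDir S I)) :
    IsGP κ r ∧ IsGP κ c := by
  obtain ⟨hr, hc⟩ := isExtGenPerm_of_prodSet h hf.ext hS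
  cases κ
  · have hne := (isGenPerm_iff.mp hf).2
    refine ⟨isGenPerm_iff.mpr ⟨hr, fun y => ?_⟩, isGenPerm_iff.mpr ⟨hc, fun y => ?_⟩⟩
    · have := hne (glue S I y 0)
      rw [maxFace_prodSet_glue] at this
      exact (nonempty_of_prodSet_nonempty h this).1
    · have := hne (glue S I 0 y)
      rw [maxFace_prodSet_glue] at this
      exact (nonempty_of_prodSet_nonempty h this).2
  · exact ⟨hr, hc⟩

/-- A generalized permutahedron on which `𝟙_S` is constant is a product. -/
lemma IsExtGenPerm.exists_eq_prodSet {S I : Finset α} (h : S ⊆ I) {f : Set (I → ℝ)}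
    (hf : IsExtGenPerm f) (hS : f ⊆ maxFace f (indicatorDir S I)) :
    ∃ r c, f = prodSet h r c := by
  obtain ⟨x₀, hx₀⟩ := hf.2.1
  -- The factors are the slices of `f` through one of its points.
  refine ⟨{u | glue S I u (Finset.restrict₂ (π := fun _ => ℝ) Finset.sdiff_subset x₀) ∈ f},
    {v | glue S I (Finset.restrict₂ (π := fun _ => ℝ) h x₀) v ∈ f}, ?_⟩
  ext x
  refine ⟨fun hx => ⟨hf.glue_mem h hS hx hx₀, hf.glue_mem h hS hx₀ hx⟩, fun ⟨h1, h2⟩ => ?_⟩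
  have := hf.glue_mem h hS h1 h2
  rwa [restrict_glue_left, restrict_glue_right, glue_restrict] at this

variable {κ : Kind} {S I : Finset α} (h : S ⊆ I)

/-- With uniqueness, this pins down the choice in `GP.coproduct`: the value `0` occurs only when the
maximum face is empty. -/
lemma GP.exists_isMinors (p : GP κ I) (hne : (maxFace p.1 (indicatorDir S I)).Nonempty) :
    ∃ rc : GP κ S × GP κ (I \ S), p.IsMinors h rc := by
  have hf := isGP_maxFace p.2 hne
  have hS : maxFace p.1 (indicatorDir S I) ⊆
      maxFace (maxFace p.1 (indicatorDir S I)) (indicatorDir S I) :=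
    fun x hx => ⟨hx, fun x' hx' => hx.2 x' hx'.1⟩
  obtain ⟨r, c, hrc⟩ := hf.ext.exists_eq_prodSet h hS
  obtain ⟨hr, hc⟩ := isGP_of_prodSet h (hrc ▸ hf) (hrc ▸ hS)
  exact ⟨(⟨r, hr⟩, ⟨c, hc⟩), hrc⟩

variable {h}

lemma GP.IsMinors.unique {p : GP κ I} {rc rc' : GP κ S × GP κ (I \ S)} (h1 : p.IsMinors h rc)
    (h2 : p.IsMinors h rc') : rc = rc' := by
  have e : prodSet h rc.1.1 rc.2.1 = prodSet h rc'.1.1 rc'.2.1 := h1.symm.trans h2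
  have s1 := subset_of_prodSet_subset h e.subset
  have s2 := subset_of_prodSet_subset h e.symm.subset
  exact Prod.ext
    (Subtype.ext ((s1.1 rc.2.2.nonempty).antisymm (s2.1 rc'.2.2.nonempty)))
    (Subtype.ext ((s1.2 rc.1.2.nonempty).antisymm (s2.2 rc'.1.2.nonempty)))

lemma GP.IsMinors.nonempty {p : GP κ I} {rc : GP κ S × GP κ (I \ S)} (h1 : p.IsMinors h rc) :
    (maxFace p.1 (indicatorDir S I)).Nonempty := by
  have e : maxFace p.1 (indicatorDir S I) = (GP.prod h rc.1 rc.2).1 := h1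
  rw [e]
  exact (GP.prod h rc.1 rc.2).2.nonempty

variable (K : Type*) [Field K]

lemma GP.IsMinors.coproduct_eq {p : GP κ I} {rc : GP κ S × GP κ (I \ S)} (h1 : p.IsMinors h rc) :
    GP.coproduct K h p = Finsupp.single rc.1 1 ⊗ₜ[K] Finsupp.single rc.2 1 := by
  have hex : ∃ rc : GP κ S × GP κ (I \ S), p.IsMinors h rc := ⟨rc, h1⟩
  rw [GP.coproduct, dif_pos hex, hex.choose_spec.unique h1]

lemma GP.coproduct_eq_zero {p : GP κ I} (hp : ¬ (maxFace p.1 (indicatorDir S I)).Nonempty) :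
    GP.coproduct K h p = 0 := by
  rw [GP.coproduct, dif_neg]
  rintro ⟨rc, hrc⟩
  exact hp hrc.nonempty

lemma gpOperations_comul_single (p : GP κ I) :
    (gpOperations K κ).comul h (Finsupp.single p 1) = GP.coproduct K h p := by
  simp [gpOperations]

lemma gpOperations_mul_single (p : GP κ S) (q : GP κ (I \ S)) :
    (gpOperations K κ).mul h (Finsupp.single p 1 ⊗ₜ[K] Finsupp.single q 1) =
      Finsupp.single (GP.prod h p q) 1 := by
  simp [gpOperations]

open Classical in
/-- The maximum face of `p` in a direction as a basis vector, or zero if there is none. -/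
def GP.maxFaceVector (p : GP κ I) (y : I → ℝ) : GP κ I →₀ K :=
  if hne : (maxFace p.1 y).Nonempty then Finsupp.single ⟨maxFace p.1 y, isGP_maxFace p.2 hne⟩ 1
  else 0

variable {K}

omit [DecidableEq α] in
lemma GP.maxFaceVector_eq_single {p q : GP κ I} {y : I → ℝ} (hq : maxFace p.1 y = q.1) :
    p.maxFaceVector K y = Finsupp.single q 1 := by
  have hne : (maxFace p.1 y).Nonempty := hq ▸ q.2.nonempty
  rw [GP.maxFaceVector, dif_pos hne]
  congr 1
  exact Subtype.ext hq

omit [DecidableEq α] in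
lemma GP.maxFaceVector_eq_zero {p : GP κ I} {y : I → ℝ} (hp : ¬ (maxFace p.1 y).Nonempty) :
    p.maxFaceVector K y = 0 := dif_neg hp

/-- The direction that ranks the elements of the `i`-th set of a list by the number of sets
from there to the end of the list. -/
def listDir : List (Finset α) → α → ℝ
  | [], _ => 0
  | S :: L, a => if a ∈ S then L.length + 1 else listDir L a

lemma listDir_le_length (L : List (Finset α)) (a : α) : listDir L a ≤ L.length := by
  induction L with
  | nil => simp [listDir]
  | cons S L ih =>
    simp only [listDir, List.length_cons, Nat.cast_add, Nat.cast_one]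
    split_ifs
    · exact le_rfl
    · linarith

omit [DecidableEq α] in
lemma maxFace_const {p : Set (I → ℝ)} (hp : IsExtGenPerm p) {y : I → ℝ}
    (hy : ∀ i j, y i = y j) : maxFace p y = p := by
  conv_rhs => rw [← maxFace_zero p]
  exact hp.maxFace_eq (fun _ _ _ => le_rfl) (fun i j _ => (hy i j).le)

/-- On a basis element, `μ_{S₁,…,S_k} ∘ Δ_{S₁,…,S_k}` gives the maximum face in the corresponding
direction of the braid fan. -/
theorem mulComul_single (L : List (Finset α)) (I : Finset α) (p : GP κ I)
    (hdisj : L.Pairwise Disjoint) (hsub : ∀ S ∈ L, S ⊆ I) (hcov : ∀ a ∈ I, ∃ S ∈ L, a ∈ S) :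
    (gpOperations K κ).mulComul L I (Finsupp.single p 1) =
      p.maxFaceVector K fun i => listDir L i := by
  induction L generalizing I with
  | nil =>
    rw [GP.maxFaceVector_eq_single (q := p) (maxFace_const p.2.ext fun _ _ => rfl)]
    rfl
  | cons S L ih =>
    cases L with
    | nil =>
      have hS : ∀ i : I, (i : α) ∈ S := fun i => by simpa using hcov i i.2
      rw [GP.maxFaceVector_eq_single (q := p)
        (maxFace_const p.2.ext fun i j => by simp [listDir, hS])]
      rfl
    | cons S' L =>
      have h : S ⊆ I := hsub S (by simp)
      rw [List.pairwise_cons] at hdisj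
      -- The first part carries the largest value of `listDir`, so maximizing along `listDir` can
      -- start with `𝟙_S`.
      have hw : indicatorDir S I ∈ braidCone fun i : I => listDir (S :: S' :: L) i := by
        intro i j hij
        have hj := listDir_le_length (S' :: L) (j : α)
        rw [List.length_cons] at hj
        simp only [indicatorDir]
        by_cases h1 : (i : α) ∈ S <;> by_cases h2 : (j : α) ∈ S <;> simp only [h1, h2, if_true,
          if_false, le_refl, zero_le_one]
        change listDir (S :: S' :: L) i ≤ listDir (S :: S' :: L) j at hij
        rw [listDir, if_pos h1, listDir, if_neg h2, List.length_cons] at hij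
        linarith
      rw [Operations.mulComul, dif_pos h, LinearMap.comp_apply, LinearMap.comp_apply,
        gpOperations_comul_single]
      by_cases hne : (maxFace p.1 (indicatorDir S I)).Nonempty
      · obtain ⟨⟨r, c⟩, hrc⟩ := p.exists_isMinors h hne
        rw [hrc.coproduct_eq K, TensorProduct.map_tmul, LinearMap.id_apply,
          ih (I \ S) c hdisj.2
            (fun T hT => Finset.subset_sdiff.mpr
              ⟨hsub T (List.mem_cons_of_mem _ hT), (hdisj.1 T hT).symm⟩)
            (fun a ha => by
              obtain ⟨haI, haS⟩ := Finset.mem_sdiff.mp ha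
              obtain ⟨T, hT, haT⟩ := hcov a haI
              rcases List.mem_cons.mp hT with rfl | hT
              exacts [absurd haT haS, ⟨T, hT, haT⟩])]
        -- After maximizing `𝟙_S` the face is `r × c`. The direction is constant on `S`, hence keeps
        -- all of `r`, and restricts to the direction of the shorter list on the rest.
        have e : maxFace p.1 (fun i : I => listDir (S :: S' :: L) i) =
            prodSet h r.1 (maxFace c.1 fun i => listDir (S' :: L) i) := by
          have e1 : maxFace p.1 (indicatorDir S I) = prodSet h r.1 c.1 := hrc
          rw [← p.2.ext.maxFace_maxFace_of_mem hw, e1, maxFace_prodSet]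
          congr 1
          · exact maxFace_const r.2.ext fun i j => by simp [Finset.restrict₂, listDir, i.2, j.2]
          · congr 1
            ext i
            have := (Finset.mem_sdiff.mp i.2).2
            simp [Finset.restrict₂, listDir, this]
        by_cases hc : (maxFace c.1 fun i => listDir (S' :: L) i).Nonempty
        · obtain ⟨q, hq⟩ : ∃ q : GP κ (I \ S), (maxFace c.1 fun i => listDir (S' :: L) i) = q.1 :=
            ⟨⟨_, isGP_maxFace c.2 hc⟩, rfl⟩
          rw [hq] at e
          rw [GP.maxFaceVector_eq_single hq, GP.maxFaceVector_eq_single (q := GP.prod h r q) e]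
          exact gpOperations_mul_single K r q
        · rw [GP.maxFaceVector_eq_zero hc, TensorProduct.tmul_zero, map_zero,
            GP.maxFaceVector_eq_zero]
          rw [e]
          exact fun hne => hc (nonempty_of_prodSet_nonempty h hne).2
      · rw [GP.coproduct_eq_zero K hne, map_zero, map_zero, GP.maxFaceVector_eq_zero]
        exact fun hne' => hne (hne'.mono (p.2.ext.maxFace_subset hw))

end Minors

/-! ### Additivity of the Euler characteristic over arrangement cells -/

section EulerCharacteristic

variable {V : Type*} [AddCommGroup V] [Module ℝ V]

/-- A convex set that is open in its affine span: its segments can be prolonged. -/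
def IsRelOpenConvex (U : Set V) : Prop :=
  Convex ℝ U ∧ ∀ x ∈ U, ∀ y ∈ U, ∃ ε : ℝ, 0 < ε ∧ x + ε • (x - y) ∈ U

open Classical in
/-- The Euler characteristic with compact support of a relatively open convex set. -/
def eulerChar (R : Type*) [Ring R] (U : Set V) : R :=
  if U.Nonempty then (-1) ^ Module.finrank ℝ (vectorSpan ℝ U) else 0

/-- The points at which `f` has the given sign. -/
def signSet (f : V →ₗ[ℝ] ℝ) (s : SignType) : Set V := {x | SignType.sign (f x) = s}

lemma mem_signSet_neg_one {f : V →ₗ[ℝ] ℝ} {x : V} : x ∈ signSet f (-1) ↔ f x < 0 := sign_eq_neg_one_iff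
lemma mem_signSet_zero {f : V →ₗ[ℝ] ℝ} {x : V} : x ∈ signSet f 0 ↔ f x = 0 := sign_eq_zero_iff
lemma mem_signSet_one {f : V →ₗ[ℝ] ℝ} {x : V} : x ∈ signSet f 1 ↔ 0 < f x := sign_eq_one_iff

lemma signSet_neg (f : V →ₗ[ℝ] ℝ) : signSet (-f) (1 : SignType) = signSet f (-1) := by
  ext x
  rw [mem_signSet_one, mem_signSet_neg_one]
  simp

/-- Small prolongations of a segment of a relatively open convex set stay in the set. -/
lemma IsRelOpenConvex.eventually_mem {U : Set V} (hU : IsRelOpenConvex U) {x y : V} (hx : x ∈ U)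
    (hy : y ∈ U) : ∀ᶠ ε : ℝ in nhdsWithin 0 (Set.Ioi 0), x + ε • (x - y) ∈ U := by
  obtain ⟨δ, hδ, hmem⟩ := hU.2 x hx y hy
  filter_upwards [Ioo_mem_nhdsGT hδ] with ε hε
  have := hU.1.add_smul_sub_mem hx hmem (t := ε / δ)
    ⟨(div_pos hε.1 hδ).le, (div_le_one hδ).mpr hε.2.le⟩
  rwa [add_sub_cancel_left, smul_smul, div_mul_cancel₀ _ hδ.ne'] at this

lemma IsRelOpenConvex.inter_pos {U : Set V} (hU : IsRelOpenConvex U) (f : V →ₗ[ℝ] ℝ) :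
    IsRelOpenConvex (U ∩ signSet f 1) := by
  constructor
  · refine hU.1.inter ?_
    have : signSet f 1 = {x | 0 < f x} := Set.ext fun x => mem_signSet_one
    rw [this]
    exact convex_halfSpace_gt f.isLinear 0
  · rintro x ⟨hx, hfx⟩ y ⟨hy, -⟩
    rw [mem_signSet_one] at hfx
    have hc : Filter.Tendsto (fun ε : ℝ => f x + ε * (f x - f y)) (nhds 0)
        (nhds (f x + 0 * (f x - f y))) := by
      apply Continuous.tendsto
      fun_prop
    have h0 : 0 < f x + 0 * (f x - f y) := by linarith
    obtain ⟨ε, ⟨h1, h2⟩, h3⟩ := (((hU.eventually_mem hx hy).and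
      ((hc.mono_left nhdsWithin_le_nhds).eventually (lt_mem_nhds h0))).and
      self_mem_nhdsWithin).exists
    refine ⟨ε, h3, h1, mem_signSet_one.mpr ?_⟩
    simpa using h2

lemma IsRelOpenConvex.inter_zero {U : Set V} (hU : IsRelOpenConvex U) (f : V →ₗ[ℝ] ℝ) :
    IsRelOpenConvex (U ∩ signSet f 0) := by
  constructor
  · refine hU.1.inter ?_
    have : signSet f 0 = {x | f x = 0} := Set.ext fun x => mem_signSet_zero
    rw [this]
    exact convex_hyperplane f.isLinear 0
  · rintro x ⟨hx, hfx⟩ y ⟨hy, hfy⟩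
    rw [mem_signSet_zero] at hfx hfy
    obtain ⟨ε, h1, h2⟩ := hU.2 x hx y hy
    exact ⟨ε, h1, h2, mem_signSet_zero.mpr (by simp [hfx, hfy])⟩

lemma IsRelOpenConvex.inter_signSet {U : Set V} (hU : IsRelOpenConvex U) (f : V →ₗ[ℝ] ℝ)
    (s : SignType) : IsRelOpenConvex (U ∩ signSet f s) := by
  cases s
  · exact hU.inter_zero f
  · have := hU.inter_pos (-f)
    rwa [signSet_neg] at this
  · exact hU.inter_pos f

/-- For `x` in the piece and any `y ∈ U`, a short prolongation of the segment from `y` beyond `x`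
stays in the piece, so `y - x` is a multiple of a difference of two of its points. -/
lemma IsRelOpenConvex.vectorSpan_inter_pos {U : Set V} (hU : IsRelOpenConvex U) (f : V →ₗ[ℝ] ℝ)
    (hne : (U ∩ signSet f 1).Nonempty) : vectorSpan ℝ (U ∩ signSet f 1) = vectorSpan ℝ U := by
  obtain ⟨x, hx⟩ := hne
  refine le_antisymm (vectorSpan_mono ℝ Set.inter_subset_left) ?_
  rw [vectorSpan_eq_span_vsub_set_right ℝ hx.1, Submodule.span_le]
  rintro _ ⟨y, hy, rfl⟩
  have hfx := mem_signSet_one.mp hx.2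
  have hc : Filter.Tendsto (fun ε : ℝ => f x + ε * (f x - f y)) (nhds 0)
      (nhds (f x + 0 * (f x - f y))) := by
    apply Continuous.tendsto
    fun_prop
  have h0 : 0 < f x + 0 * (f x - f y) := by linarith
  obtain ⟨ε, ⟨h1, h2⟩, h3⟩ := (((hU.eventually_mem hx.1 hy).and
    ((hc.mono_left nhdsWithin_le_nhds).eventually (lt_mem_nhds h0))).and
    self_mem_nhdsWithin).exists
  have hmem : x + ε • (x - y) ∈ U ∩ signSet f 1 := ⟨h1, mem_signSet_one.mpr (by simpa using h2)⟩
  have := Submodule.smul_mem _ (-ε⁻¹) (vsub_mem_vectorSpan ℝ hmem hx)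
  have h3 : ε ≠ 0 := (Set.mem_Ioi.mp h3).ne'
  simpa [smul_smul, h3] using this

lemma IsRelOpenConvex.vectorSpan_inter_zero {U : Set V} (hU : IsRelOpenConvex U) (f : V →ₗ[ℝ] ℝ)
    {x : V} (hx : x ∈ U ∩ signSet f 0) :
    vectorSpan ℝ (U ∩ signSet f 0) = vectorSpan ℝ U ⊓ LinearMap.ker f := by
  have hfx := mem_signSet_zero.mp hx.2
  apply le_antisymm
  · refine le_inf (vectorSpan_mono ℝ Set.inter_subset_left) ?_
    rw [vectorSpan_eq_span_vsub_set_right ℝ hx, Submodule.span_le]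
    rintro _ ⟨y, hy, rfl⟩
    simp [hfx, mem_signSet_zero.mp hy.2]
  · rintro v ⟨hv, hfv⟩
    -- From `x` one can move a little in every direction of the span: convexity handles sums,
    -- prolongation handles negative multiples.
    have key : ∀ v ∈ vectorSpan ℝ U, ∃ ε : ℝ, 0 < ε ∧ x + ε • v ∈ U := by
      intro v hv
      rw [vectorSpan_eq_span_vsub_set_right ℝ hx.1] at hv
      induction hv using Submodule.span_induction with
      | mem v hv =>
        obtain ⟨y, hy, rfl⟩ := hv
        exact ⟨1, one_pos, by simpa using hy⟩
      | zero => exact ⟨1, one_pos, by simpa using hx.1⟩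
      | add v w _ _ hv hw =>
        obtain ⟨a, ha, hv⟩ := hv
        obtain ⟨b, hb, hw⟩ := hw
        -- This is the step length at the convex combination of `x + a • v` and `x + b • w` that
        -- gives `v` and `w` equal weight.
        refine ⟨a * b / (a + b), by positivity, ?_⟩
        have := hU.1 hv hw (show 0 ≤ b / (a + b) by positivity)
          (show 0 ≤ a / (a + b) by positivity) (by field_simp; ring)
        convert this using 1
        match_scalars <;> field_simp
        ring
      | smul c v _ hv =>
        obtain ⟨a, ha, hv⟩ := hv
        rcases lt_trichotomy c 0 with hc | rfl | hc
        · obtain ⟨ε, hε, h⟩ := hU.2 x hx.1 _ hv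
          refine ⟨ε * a / (-c), div_pos (mul_pos hε ha) (neg_pos.mpr hc), ?_⟩
          convert h using 2
          rw [sub_add_cancel_left, smul_neg, smul_smul, smul_smul, ← neg_smul]
          congr 1
          have := hc.ne
          field_simp
        · exact ⟨1, one_pos, by simpa using hx.1⟩
        · refine ⟨a / c, div_pos ha hc, ?_⟩
          rwa [smul_smul, div_mul_cancel₀ _ hc.ne']
    obtain ⟨ε, hε, h⟩ := key v hv
    have hmem : x + ε • v ∈ U ∩ signSet f 0 :=
      ⟨h, mem_signSet_zero.mpr (by simp [hfx, LinearMap.mem_ker.mp hfv])⟩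
    have := Submodule.smul_mem _ ε⁻¹ (vsub_mem_vectorSpan ℝ hmem hx)
    simpa [smul_smul, hε.ne'] using this

variable [FiniteDimensional ℝ V] (R : Type*) [Ring R]

/-- The open half has the dimension of `U`. The slice has one less, as `f` is not constant on `U`,
so the signs are opposite. -/
lemma IsRelOpenConvex.sum_eulerChar_signSet_of_neg {U : Set V} (hU : IsRelOpenConvex U)
    (f : V →ₗ[ℝ] ℝ) (hpos : (U ∩ signSet f 1).Nonempty) (hneg : (U ∩ signSet f (-1)).Nonempty) :
    eulerChar R (U ∩ signSet f 0) + eulerChar R (U ∩ signSet f 1) = 0 := by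
  obtain ⟨x, hxU, hx⟩ := hpos
  obtain ⟨y, hyU, hy⟩ := hneg
  have hpos : (U ∩ signSet f 1).Nonempty := ⟨x, hxU, hx⟩
  rw [mem_signSet_one] at hx
  rw [mem_signSet_neg_one] at hy
  have hd : 0 < f x - f y := by linarith
  -- The zero of `f` on the segment from `x` to `y`.
  have hm : (-f y / (f x - f y)) • x + (f x / (f x - f y)) • y ∈ U ∩ signSet f 0 := by
    refine ⟨hU.1 hxU hyU (div_pos (by linarith) hd).le (div_pos hx hd).le ?_,
      mem_signSet_zero.mpr ?_⟩
    · field_simp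
      ring
    · simp only [map_add, map_smul, smul_eq_mul]
      field_simp
      ring
  rw [eulerChar, eulerChar, if_pos ⟨_, hm⟩, if_pos hpos, hU.vectorSpan_inter_zero f hm,
    hU.vectorSpan_inter_pos f hpos]
  set W := vectorSpan ℝ U
  let g : W →ₗ[ℝ] ℝ := f ∘ₗ W.subtype
  have hsurj : LinearMap.range g = ⊤ := by
    refine LinearMap.range_eq_top.mpr fun c => ?_
    have hmem : x - y ∈ W := vsub_mem_vectorSpan ℝ hxU hyU
    refine ⟨(c / (f x - f y)) • ⟨x - y, hmem⟩, ?_⟩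
    simp only [g, map_smul, LinearMap.comp_apply, Submodule.subtype_apply, map_sub, smul_eq_mul]
    exact div_mul_cancel₀ _ hd.ne'
  have hker : Module.finrank ℝ (LinearMap.ker g) = Module.finrank ℝ ↥(W ⊓ LinearMap.ker f) := by
    rw [LinearMap.ker_comp, ← Submodule.map_comap_subtype]
    exact (Submodule.finrank_map_subtype_eq _ _).symm
  have := LinearMap.finrank_range_add_finrank_ker g
  rw [hsurj, finrank_top, Module.finrank_self, hker] at this
  rw [← this, pow_add, pow_one, neg_one_mul, add_neg_cancel]

/-- If `U` meets both sides, the slice cancels one half and the other half has the value of `U`. If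
it meets exactly one side, it misses the hyperplane, since prolonging a segment through a zero of
`f` would reach the other side. If it meets neither, it lies in the hyperplane. -/
lemma IsRelOpenConvex.sum_eulerChar_signSet {U : Set V} (hU : IsRelOpenConvex U)
    (f : V →ₗ[ℝ] ℝ) : ∑ s : SignType, eulerChar R (U ∩ signSet f s) = eulerChar R U := by
  have hsum : ∑ s : SignType, eulerChar R (U ∩ signSet f s) = eulerChar R (U ∩ signSet f 0) +
      (eulerChar R (U ∩ signSet f (-1)) + eulerChar R (U ∩ signSet f 1)) := by
    have : (Finset.univ : Finset SignType) = {0, -1, 1} := rfl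
    rw [this, Finset.sum_insert (by decide), Finset.sum_insert (by decide), Finset.sum_singleton]
  rw [hsum]
  have hempty : ∀ W : Set V, ¬ W.Nonempty → eulerChar R W = 0 := fun W hW => if_neg hW
  have e1 : (U ∩ signSet f 1).Nonempty → eulerChar R (U ∩ signSet f 1) = eulerChar R U := by
    intro h
    rw [eulerChar, eulerChar, if_pos h, if_pos (h.mono Set.inter_subset_left),
      hU.vectorSpan_inter_pos f h]
  have e2 : (U ∩ signSet f (-1)).Nonempty → eulerChar R (U ∩ signSet f (-1)) = eulerChar R U := by
    intro h
    rw [← signSet_neg] at h ⊢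
    rw [eulerChar, eulerChar, if_pos h, if_pos (h.mono Set.inter_subset_left),
      hU.vectorSpan_inter_pos (-f) h]
  by_cases hp : (U ∩ signSet f 1).Nonempty
  · by_cases hn : (U ∩ signSet f (-1)).Nonempty
    · have := hU.sum_eulerChar_signSet_of_neg R f hp hn
      rw [e1 hp] at this
      rw [e2 hn, e1 hp, ← add_assoc, this, zero_add]
    · have hz : ¬ (U ∩ signSet f 0).Nonempty := by
        rintro ⟨x, hxU, hx⟩
        obtain ⟨y, hyU, hy⟩ := hp
        obtain ⟨ε, hε, hmem⟩ := hU.2 x hxU y hyU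
        refine hn ⟨_, hmem, mem_signSet_neg_one.mpr ?_⟩
        have := mul_pos hε (mem_signSet_one.mp hy)
        simp only [map_add, map_smul, map_sub, mem_signSet_zero.mp hx, smul_eq_mul]
        linarith
      rw [hempty _ hn, hempty _ hz, e1 hp, zero_add, zero_add]
  · by_cases hn : (U ∩ signSet f (-1)).Nonempty
    · have hz : ¬ (U ∩ signSet f 0).Nonempty := by
        rintro ⟨x, hxU, hx⟩
        obtain ⟨y, hyU, hy⟩ := hn
        obtain ⟨ε, hε, hmem⟩ := hU.2 x hxU y hyU
        refine hp ⟨_, hmem, mem_signSet_one.mpr ?_⟩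
        have := mul_pos hε (neg_pos.mpr (mem_signSet_neg_one.mp hy))
        simp only [map_add, map_smul, map_sub, mem_signSet_zero.mp hx, smul_eq_mul]
        linarith
      rw [hempty _ hp, hempty _ hz, e2 hn, zero_add, add_zero]
    · have hz : U ∩ signSet f 0 = U := by
        refine Set.inter_eq_left.mpr fun x hx => mem_signSet_zero.mpr ?_
        rcases lt_trichotomy (f x) 0 with h | h | h
        · exact absurd ⟨x, hx, mem_signSet_neg_one.mpr h⟩ hn
        · exact h
        · exact absurd ⟨x, hx, mem_signSet_one.mpr h⟩ hp
      rw [hempty _ hp, hempty _ hn, hz, add_zero, add_zero]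

/-- The Euler characteristic is additive over the cells of a hyperplane arrangement. -/
theorem IsRelOpenConvex.sum_eulerChar_cells {τ : Type*} [DecidableEq τ] (A : Finset τ)
    (f : τ → V →ₗ[ℝ] ℝ) {U : Set V} (hU : IsRelOpenConvex U) :
    ∑ σ ∈ A.pi fun _ => (Finset.univ : Finset SignType),
      eulerChar R (U ∩ {x | ∀ t (ht : t ∈ A), SignType.sign (f t x) = σ t ht}) =
      eulerChar R U := by
  induction A using Finset.induction_on generalizing U with
  | empty => simp
  | insert a A ha ih =>
    rw [Finset.pi_insert ha, Finset.sum_biUnion]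
    -- Cutting by `f a` leaves pieces that are again relatively open and convex, so induction
    -- applies to each.
    · rw [← hU.sum_eulerChar_signSet R (f a)]
      refine Finset.sum_congr rfl fun s _ => ?_
      rw [Finset.sum_image fun _ _ _ _ h => Finset.Pi.cons_injective ha h,
        ← ih (hU.inter_signSet (f a) s)]
      refine Finset.sum_congr rfl fun σ _ => ?_
      congr 1
      ext x
      simp only [Set.mem_inter_iff, Set.mem_ofPred_eq, and_assoc, signSet]
      refine and_congr_right fun _ => ?_
      constructor
      · intro h
        refine ⟨by simpa using h a (Finset.mem_insert_self a A), fun t ht => ?_⟩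
        rw [h t (Finset.mem_insert_of_mem ht),
          Finset.Pi.cons_ne (ne_of_mem_of_not_mem ht ha).symm]
      · rintro ⟨h1, h2⟩ t ht
        by_cases hta : t = a
        · subst hta
          simpa using h1
        · rw [h2 t (Finset.mem_of_mem_insert_of_ne ht hta), Finset.Pi.cons_ne (Ne.symm hta)]
    · intro s _ s' _ hne
      rw [Function.onFun, Finset.disjoint_left]
      intro σ h1 h2
      obtain ⟨g, -, rfl⟩ := Finset.mem_image.mp h1
      obtain ⟨g', -, h⟩ := Finset.mem_image.mp h2
      have := congrFun (congrFun h a) (Finset.mem_insert_self a A)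
      rw [Finset.Pi.cons_same, Finset.Pi.cons_same] at this
      exact hne this.symm

end EulerCharacteristic

/-! ### Dimensions of open normal cones and of braid cells -/

section NormalCones

variable {ι : Type*} [Fintype ι]

/-- The directions with a given maximum face form a relatively open convex cone. -/
lemma IsPolyhedron.isRelOpenConvex_setOf_maxFace_eq {p q : Set (ι → ℝ)} (hp : IsPolyhedron p)
    (hq : q.Nonempty) : IsRelOpenConvex {y | maxFace p y = q} := by
  obtain ⟨x₀, hx₀⟩ := hq
  constructor
  · rintro y (hy : maxFace p y = q) z (hz : maxFace p z = q) a b ha hb hab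
    have h1 : x₀ ∈ maxFace p y := hy ▸ hx₀
    have h2 : x₀ ∈ maxFace p z := hz ▸ hx₀
    change maxFace p (a • y + b • z) = q
    ext x
    constructor
    · rintro ⟨hx, hmax⟩
      have h3 := hmax x₀ h1.1
      simp only [add_dotProduct, smul_dotProduct, smul_eq_mul] at h3
      have h4 := mul_le_mul_of_nonneg_left (h1.2 x hx) ha
      have h5 := mul_le_mul_of_nonneg_left (h2.2 x hx) hb
      rcases ha.eq_or_lt with rfl | ha
      · rw [← hz]
        have hb1 : b = 1 := by linarith
        subst hb1
        exact ⟨hx, fun x' hx' => (h2.2 x' hx').trans (by linarith)⟩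
      · rw [← hy]
        exact ⟨hx, fun x' hx' => (h1.2 x' hx').trans
          (le_of_mul_le_mul_left (by linarith : a * _ ≤ a * _) ha)⟩
    · intro hx
      have h3 : x ∈ maxFace p y := hy ▸ hx
      have h4 : x ∈ maxFace p z := hz ▸ hx
      refine ⟨h3.1, fun x' hx' => ?_⟩
      simp only [add_dotProduct, smul_dotProduct, smul_eq_mul]
      exact add_le_add (mul_le_mul_of_nonneg_left (h3.2 x' hx') ha)
        (mul_le_mul_of_nonneg_left (h4.2 x' hx') hb)
  · rintro y (hy : maxFace p y = q) z (hz : maxFace p z = q)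
    -- Both `y` and `z` are constant on `q`, so perturbing `y` along `y - z` does not change the
    -- maximum face.
    have hconst : maxFace (maxFace p y) (y - z) = maxFace p y := by
      refine Set.Subset.antisymm (fun _ h => h.1) fun x hx => ⟨hx, fun x' hx' => ?_⟩
      have h1 := hx.2 x' hx'.1
      have h2 := hx'.2 x hx.1
      rw [hy, ← hz] at hx hx'
      have h3 := hx'.2 x hx.1
      simp only [sub_dotProduct]
      linarith
    have hne : (maxFace (maxFace p y) (y - z)).Nonempty := by
      rw [hconst, hy]
      exact ⟨x₀, hx₀⟩
    obtain ⟨ε, hε, hpos⟩ := ((hp.eventually_maxFace_add_smul hne).and self_mem_nhdsWithin).exists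
    exact ⟨ε, hpos, hε.trans (hconst.trans hy)⟩

/-- The linear span of the normal cone at `q` is the orthogonal complement of `q`. -/
lemma IsPolyhedron.mem_vectorSpan_setOf_maxFace_eq {p q : Set (ι → ℝ)} (hp : IsPolyhedron p)
    (hq : IsFace q p) {v : ι → ℝ} :
    v ∈ vectorSpan ℝ {y | maxFace p y = q} ↔ ∀ w ∈ vectorSpan ℝ q, v ⬝ᵥ w = 0 := by
  obtain ⟨hne, y, rfl⟩ := hq
  rw [← subset_maxFace_iff]
  have hy : y ∈ {z | maxFace p z = maxFace p y} := rfl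
  constructor
  · intro hv
    rw [subset_maxFace_iff]
    induction hv using Submodule.span_induction with
    | mem v hv =>
      obtain ⟨a, ha, b, hb, rfl⟩ := hv
      have ha' : maxFace p a = maxFace p y := ha
      have hb' : maxFace p b = maxFace p y := hb
      rw [← subset_maxFace_iff]
      refine fun x hx => ⟨hx, fun x' hx' => ?_⟩
      have h1 := (ha' ▸ hx : x ∈ maxFace p a).2 x' hx'.1
      have h2 := (hb' ▸ hx' : x' ∈ maxFace p b).2 x hx.1
      simp only [vsub_eq_sub, sub_dotProduct]
      linarith
    | zero => exact fun w _ => zero_dotProduct w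
    | add v v' _ _ h h' => exact fun w hw => by rw [add_dotProduct, h w hw, h' w hw, add_zero]
    | smul c v _ h => exact fun w hw => by rw [smul_dotProduct, h w hw, smul_zero]
  · intro hv
    have hconst : maxFace (maxFace p y) v = maxFace p y :=
      Set.Subset.antisymm (fun _ h => h.1) hv
    obtain ⟨ε, hε, hpos⟩ := ((hp.eventually_maxFace_add_smul (hconst.symm ▸ hne)).and
      self_mem_nhdsWithin).exists
    have hpos : ε ≠ 0 := (Set.mem_Ioi.mp hpos).ne'
    have hmem : y + ε • v ∈ {z | maxFace p z = maxFace p y} := hε.trans hconst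
    have := Submodule.smul_mem _ ε⁻¹ (vsub_mem_vectorSpan ℝ hmem hy)
    simpa [smul_smul, hpos] using this

/-- Under the dot product the span of the open normal cone is the annihilator of the directions of
`q`. -/
lemma IsPolyhedron.finrank_vectorSpan_setOf_maxFace_eq {p q : Set (ι → ℝ)} (hp : IsPolyhedron p)
    (hq : IsFace q p) :
    dim q + Module.finrank ℝ (vectorSpan ℝ {y | maxFace p y = q}) = Fintype.card ι := by
  classical
  have e : vectorSpan ℝ {y | maxFace p y = q} =
      (vectorSpan ℝ q).dualAnnihilator.comap (dotProductEquiv ℝ ι).toLinearMap := by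
    ext v
    rw [hp.mem_vectorSpan_setOf_maxFace_eq hq, Submodule.mem_comap, Submodule.mem_dualAnnihilator]
    rfl
  have e2 : Module.finrank ℝ ((vectorSpan ℝ q).dualAnnihilator.comap
      (dotProductEquiv ℝ ι).toLinearMap) = Module.finrank ℝ (vectorSpan ℝ q).dualAnnihilator := by
    rw [Submodule.comap_equiv_eq_map_symm]
    exact LinearEquiv.finrank_map_eq _ _
  rw [e, e2, dim, Subspace.finrank_add_finrank_dualAnnihilator_eq, Module.finrank_fintype_fun_eq_card]

lemma IsPolyhedron.eulerChar_setOf_maxFace_eq (R : Type*) [CommRing R] {p q : Set (ι → ℝ)}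
    (hp : IsPolyhedron p) (hq : IsFace q p) :
    eulerChar R {y | maxFace p y = q} = (-1) ^ Fintype.card ι * (-1) ^ dim q := by
  obtain ⟨-, y, hy⟩ := id hq
  rw [eulerChar, if_pos ⟨y, hy.symm⟩, ← hp.finrank_vectorSpan_setOf_maxFace_eq hq, pow_add,
    mul_right_comm, ← mul_pow]
  simp

lemma sign_sub_eq_sign_sub_iff {a b c d : ℝ} :
    SignType.sign (a - b) = SignType.sign (c - d) ↔ (a ≤ b ↔ c ≤ d) ∧ (b ≤ a ↔ d ≤ c) := by
  have key : ∀ a b c d : ℝ, SignType.sign (a - b) = SignType.sign (c - d) → (a ≤ b ↔ c ≤ d) := by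
    intro a b c d h
    rw [← sub_nonpos, ← sub_nonpos (a := c), ← sign_nonpos_iff, h, sign_nonpos_iff]
  constructor
  · intro h
    refine ⟨key a b c d h, key b a d c ?_⟩
    rw [← neg_sub, Left.sign_neg, h, ← Left.sign_neg, neg_sub]
  · rintro ⟨h1, h2⟩
    rcases lt_trichotomy a b with h | h | h
    · rw [sign_neg (by linarith), sign_neg (by linarith [not_le.mp (mt h2.mpr h.not_ge)])]
    · rw [sub_eq_zero.mpr h, sub_eq_zero.mpr ((h1.mp h.le).antisymm (h2.mp h.ge))]
    · rw [sign_pos (by linarith), sign_pos (by linarith [not_le.mp (mt h1.mpr h.not_ge)])]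

/-- The relatively open face of the braid arrangement with `k` parts has dimension `k`. -/
lemma finrank_vectorSpan_braidCell {k : ℕ} {f : ι → Fin k} (hf : Function.Surjective f)
    {y : ι → ℝ} (hy : ∀ i j, f i = f j ↔ y i = y j) :
    Module.finrank ℝ (vectorSpan ℝ
      {z : ι → ℝ | ∀ i j, SignType.sign (z i - z j) = SignType.sign (y i - y j)}) = k := by
  have e : vectorSpan ℝ
      {z : ι → ℝ | ∀ i j, SignType.sign (z i - z j) = SignType.sign (y i - y j)} =
      -- The span consists of the functions constant on the level sets of `y`, that is, of the
      -- pullbacks along `f`: a small multiple of one, added to `y`, leaves the order of the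
      -- coordinates unchanged.
      LinearMap.range (LinearMap.funLeft ℝ ℝ f) := by
    apply le_antisymm
    · refine Submodule.span_le.mpr ?_
      rintro _ ⟨a, ha, b, hb, rfl⟩
      refine ⟨fun n => (a - b) (Function.surjInv hf n), ?_⟩
      ext i
      have h := (hy (Function.surjInv hf (f i)) i).mp (Function.surjInv_eq hf (f i))
      have key : ∀ c : ι → ℝ, (∀ i j, SignType.sign (c i - c j) = SignType.sign (y i - y j)) →
          c (Function.surjInv hf (f i)) = c i := by
        intro c hc
        have := sign_sub_eq_sign_sub_iff.mp (hc (Function.surjInv hf (f i)) i)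
        exact le_antisymm (this.1.mpr h.le) (this.2.mpr h.ge)
      simp [LinearMap.funLeft_apply, key a ha, key b hb]
    · rintro _ ⟨g, rfl⟩
      set v := LinearMap.funLeft ℝ ℝ f g
      obtain ⟨ε, hε, hpos⟩ := ((eventually_le_of_add_smul_le y v).and self_mem_nhdsWithin).exists
      have hpos : ε ≠ 0 := (Set.mem_Ioi.mp hpos).ne'
      have key : ∀ i j, (y + ε • v) i ≤ (y + ε • v) j ↔ y i ≤ y j := by
        intro i j
        constructor
        · intro h
          rcases hε i j h with h | h
          exacts [h.le, h.1.le]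
        · intro h
          by_contra hlt
          rcases hε j i (not_le.mp hlt).le with h' | h'
          · exact absurd h h'.not_ge
          · have hv : v i = v j := by
              simp [v, LinearMap.funLeft_apply, (hy i j).mpr h'.1.symm]
            apply hlt
            simp [hv, h'.1]
      have hmem : y + ε • v ∈
          {z : ι → ℝ | ∀ i j, SignType.sign (z i - z j) = SignType.sign (y i - y j)} :=
        fun i j => sign_sub_eq_sign_sub_iff.mpr ⟨key i j, key j i⟩
      have hmem' : y ∈
          {z : ι → ℝ | ∀ i j, SignType.sign (z i - z j) = SignType.sign (y i - y j)} :=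
        fun i j => rfl
      have := Submodule.smul_mem _ ε⁻¹ (vsub_mem_vectorSpan ℝ hmem hmem')
      simpa [smul_smul, hpos] using this
  rw [e, LinearMap.finrank_range_of_inj (LinearMap.funLeft_injective_of_surjective ℝ ℝ f hf),
    Module.finrank_fintype_fun_eq_card, Fintype.card_fin]

end NormalCones

/-! ### Compositions as braid cells, and the antipode formula -/

section AntipodeFormula

variable {α : Type*} [DecidableEq α]

lemma mem_compositions_iff {I : Finset α} {k : ℕ} {F : Fin k → Finset α} :
    F ∈ compositions I k ↔ (∀ a, F a ⊆ I) ∧ ∃ f : I → Fin k, Function.Surjective f ∧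
      ∀ (i : I) a, (i : α) ∈ F a ↔ f i = a := by
  simp only [compositions, Finset.mem_filter, Fintype.mem_piFinset, Finset.mem_powerset]
  refine and_congr_right fun hsub => ?_
  constructor
  · rintro ⟨hne, hdisj, hcov⟩
    choose f hf using fun i : I => hcov i i.2
    have hiff : ∀ (i : I) a, (i : α) ∈ F a ↔ f i = a := fun i a =>
      ⟨fun h => by
        by_contra hne
        exact Finset.disjoint_left.mp (hdisj _ _ hne) (hf i) h, fun h => h ▸ hf i⟩
    refine ⟨f, fun a => ?_, hiff⟩
    obtain ⟨x, hx⟩ := hne a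
    exact ⟨⟨x, hsub a hx⟩, (hiff ⟨x, hsub a hx⟩ a).mp hx⟩
  · rintro ⟨f, hf, hiff⟩
    refine ⟨fun a => ?_, fun a b hab => ?_, fun x hx => ⟨f ⟨x, hx⟩, (hiff ⟨x, hx⟩ _).mpr rfl⟩⟩
    · obtain ⟨i, hi⟩ := hf a
      exact ⟨i, (hiff i a).mpr hi⟩
    · rw [Finset.disjoint_left]
      intro x ha hb
      have hx := hsub a ha
      exact hab (((hiff ⟨x, hx⟩ a).mp ha).symm.trans ((hiff ⟨x, hx⟩ b).mp hb))

lemma listDir_ofFn {k : ℕ} {F : Fin k → Finset α} {x : α} {a : Fin k}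
    (hx : ∀ b, x ∈ F b ↔ a = b) : listDir (List.ofFn F) x = (k : ℝ) - (a : ℕ) := by
  induction k with
  | zero => exact a.elim0
  | succ k ih =>
    rw [List.ofFn_succ, listDir, List.length_ofFn]
    rcases Fin.eq_zero_or_eq_succ a with rfl | ⟨b, rfl⟩
    · rw [if_pos ((hx 0).mpr rfl)]
      simp
    · rw [if_neg fun h => Fin.succ_ne_zero b ((hx 0).mp h),
        ih (a := b) fun c => by rw [hx, Fin.succ_inj]]
      simp

/-- The two surjections induce an order isomorphism `Fin k ≃o Fin k'`, and such an isomorphism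
preserves values. Hence a composition is determined by its cell. -/
lemma eq_of_le_iff_le {ι : Type*} {k k' : ℕ} {f : ι → Fin k} {g : ι → Fin k'}
    (hf : Function.Surjective f) (hg : Function.Surjective g)
    (h : ∀ i j, f i ≤ f j ↔ g i ≤ g j) : k = k' ∧ ∀ i, (f i : ℕ) = g i := by
  have hφ : ∀ i, g (Function.surjInv hf (f i)) = g i := fun i => by
    have e : f (Function.surjInv hf (f i)) = f i := Function.surjInv_eq hf (f i)
    exact le_antisymm ((h _ _).mp e.le) ((h _ _).mp e.ge)
  have hmono : StrictMono fun a => g (Function.surjInv hf a) := by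
    intro a b hab
    rw [← not_le] at hab ⊢
    rwa [← h, Function.surjInv_eq hf, Function.surjInv_eq hf]
  have hsurj : Function.Surjective fun a => g (Function.surjInv hf a) := fun b => by
    obtain ⟨i, rfl⟩ := hg b
    exact ⟨f i, hφ i⟩
  let e := hmono.orderIsoOfSurjective _ hsurj
  refine ⟨Fin.equiv_iff_eq.mp ⟨e.toEquiv⟩, fun i => ?_⟩
  rw [← hφ i]
  exact (Fin.coe_orderIso_apply e (f i)).symm

/-- Every direction lies in the cell of a composition. -/
lemma exists_composition {I : Finset α} (z : I → ℝ) :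
    ∃ k ∈ Finset.range (I.card + 1), ∃ F ∈ compositions I k, ∀ i j : I,
      listDir (List.ofFn F) i ≤ listDir (List.ofFn F) j ↔ z i ≤ z j := by
  classical
  let s := Finset.univ.image z
  let e : Fin s.card ≃o s := s.orderIsoOfFin rfl
  -- Reversal is needed because the first part of a composition carries the largest value.
  let f : I → Fin s.card := fun i => (e.symm ⟨z i, Finset.mem_image_of_mem z (Finset.mem_univ i)⟩).rev
  have hf : Function.Surjective f := by
    intro a
    obtain ⟨i, -, hi⟩ := Finset.mem_image.mp (e a.rev).2
    refine ⟨i, ?_⟩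
    simp only [f, hi]
    simp
  let F : Fin s.card → Finset α := fun a => (Finset.univ.filter fun i => f i = a).map
    (Function.Embedding.subtype _)
  have hF : ∀ (i : I) a, (i : α) ∈ F a ↔ f i = a := by
    intro i a
    simp [F]
  refine ⟨s.card, ?_, F, mem_compositions_iff.mpr ⟨fun a x hx => ?_, f, hf, hF⟩, fun i j => ?_⟩
  · rw [Finset.mem_range, Nat.lt_succ_iff]
    exact Finset.card_image_le.trans (by simp)
  · obtain ⟨i, -, rfl⟩ := Finset.mem_map.mp hx
    exact i.2
  · rw [listDir_ofFn (hF i), listDir_ofFn (hF j), sub_le_sub_iff_left, Nat.cast_le,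
      Fin.val_fin_le]
    simp only [f, Fin.rev_le_rev, OrderIso.le_iff_le, Subtype.mk_le_mk]

variable {κ : Kind} {I : Finset α} {K : Type*} [Field K]

/-- The signed count of the compositions whose direction has a given maximum face. -/
lemma sum_compositions_maxFace_eq [DecidableEq (Set (I → ℝ))] {p q : Set (I → ℝ)}
    (hp : IsExtGenPerm p) (hq : IsFace q p) :
    ∑ k ∈ Finset.range (I.card + 1), ∑ F ∈ compositions I k,
      (if maxFace p (fun i => listDir (List.ofFn F) i) = q then (-1 : K) ^ k else 0) =
      (-1) ^ I.card * (-1) ^ dim q := by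
  set U := {y | maxFace p y = q} with hU
  have hopen := hp.1.isRelOpenConvex_setOf_maxFace_eq hq.1
  let f : I × I → (I → ℝ) →ₗ[ℝ] ℝ := fun t =>
    LinearMap.proj (R := ℝ) (φ := fun _ : I => ℝ) t.1 - LinearMap.proj t.2
  have hsum := hopen.sum_eulerChar_cells K (Finset.univ : Finset (I × I)) f
  rw [hp.1.eulerChar_setOf_maxFace_eq K hq, Fintype.card_coe] at hsum
  rw [← hsum, Finset.sum_sigma']
  have hcell : ∀ {y z : I → ℝ}, (∀ i j, y i ≤ y j ↔ z i ≤ z j) → maxFace p y = maxFace p z :=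
    fun h => hp.maxFace_eq (fun i j hij => (h i j).mp hij) fun i j hij => (h i j).mpr hij
  -- Each composition is matched with the sign vector of its direction. The remaining sign vectors
  -- are realized by no direction, so their cells are empty and contribute zero.
  refine Finset.sum_of_injOn (fun kF t _ =>
    SignType.sign (listDir (List.ofFn kF.2) t.1 - listDir (List.ofFn kF.2) t.2)) ?_ ?_ ?_ ?_
  · rintro ⟨k, F⟩ hF ⟨k', F'⟩ hF' heq
    obtain ⟨hsub, g, hg, hFg⟩ := mem_compositions_iff.mp (Finset.mem_sigma.mp hF).2
    obtain ⟨hsub', g', hg', hFg'⟩ := mem_compositions_iff.mp (Finset.mem_sigma.mp hF').2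
    obtain ⟨hk, hval⟩ := eq_of_le_iff_le hg hg' fun i j => by
      have h1 := congrFun (congrFun heq (i, j)) (Finset.mem_univ _)
      have h2 := (sign_sub_eq_sign_sub_iff.mp h1).2
      rwa [listDir_ofFn (hFg i), listDir_ofFn (hFg j), listDir_ofFn (hFg' i),
        listDir_ofFn (hFg' j), sub_le_sub_iff_left, sub_le_sub_iff_left, Nat.cast_le, Nat.cast_le,
        Fin.val_fin_le, Fin.val_fin_le] at h2
    dsimp only at hk
    subst hk
    congr 1
    funext a
    ext x
    constructor
    · intro hx
      have := (hFg ⟨x, hsub a hx⟩ a).mp hx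
      exact (hFg' ⟨x, hsub a hx⟩ a).mpr ((Fin.ext (hval _)).symm.trans this)
    · intro hx
      have := (hFg' ⟨x, hsub' a hx⟩ a).mp hx
      exact (hFg ⟨x, hsub' a hx⟩ a).mpr ((Fin.ext (hval _)).trans this)
  · intro _ _
    exact Finset.mem_coe.mpr (Finset.mem_pi.mpr fun _ _ => Finset.mem_univ _)
  · intro σ _ hσ
    refine if_neg ?_
    rintro ⟨z, -, hz⟩
    obtain ⟨k, hk, F, hF, hle⟩ := exists_composition z
    refine hσ ⟨⟨k, F⟩, Finset.mem_coe.mpr (Finset.mem_sigma.mpr ⟨hk, hF⟩), ?_⟩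
    funext t ht
    rw [← hz t ht]
    exact sign_sub_eq_sign_sub_iff.mpr ⟨hle _ _, hle _ _⟩
  · rintro ⟨k, F⟩ hF
    obtain ⟨hsub, g, hg, hFg⟩ := mem_compositions_iff.mp (Finset.mem_sigma.mp hF).2
    set y : I → ℝ := fun i => listDir (List.ofFn F) i with hy
    have hC : {x : I → ℝ | ∀ t (_ : t ∈ (Finset.univ : Finset (I × I))), SignType.sign (f t x) =
        SignType.sign (listDir (List.ofFn F) t.1 - listDir (List.ofFn F) t.2)} =
        {z : I → ℝ | ∀ i j, SignType.sign (z i - z j) = SignType.sign (y i - y j)} := by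
      ext z
      exact ⟨fun h i j => h (i, j) (Finset.mem_univ _), fun h t _ => h t.1 t.2⟩
    -- The maximum face is constant on a cell, so a cell either lies in `U`, where its dimension `k`
    -- gives the sign `(-1)^k`, or is disjoint from `U`.
    have hface : ∀ z ∈ {z : I → ℝ | ∀ i j, SignType.sign (z i - z j) = SignType.sign (y i - y j)},
        maxFace p z = maxFace p y :=
      fun z hz => hcell fun i j => (sign_sub_eq_sign_sub_iff.mp (hz i j)).1
    dsimp only
    rw [hC]
    split_ifs with h
    · have hinter : U ∩ {z : I → ℝ | ∀ i j, SignType.sign (z i - z j) = SignType.sign (y i - y j)}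
          = {z : I → ℝ | ∀ i j, SignType.sign (z i - z j) = SignType.sign (y i - y j)} :=
        Set.inter_eq_right.mpr fun z hz => (hface z hz).trans h
      rw [hinter, eulerChar, if_pos ⟨y, fun _ _ => rfl⟩, finrank_vectorSpan_braidCell hg]
      intro i j
      rw [hy]
      dsimp only
      rw [listDir_ofFn (hFg i), listDir_ofFn (hFg j), sub_right_inj, Nat.cast_inj, Fin.val_inj]
    · refine (if_neg ?_).symm
      rintro ⟨z, hzU, hz⟩
      exact h ((hface z hz).symm.trans hzU)

omit [DecidableEq α] in
lemma GP.mem_faces {p q : GP κ I} : q ∈ p.faces ↔ IsFace q.1 p.1 := by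
  simp [GP.faces]

-- Summing over an index set independent of the direction lets the sums over faces and compositions
-- be exchanged.
omit [DecidableEq α] in
open Classical in
lemma GP.maxFaceVector_eq_sum (p : GP κ I) (y : I → ℝ) :
    p.maxFaceVector K y =
      ∑ q ∈ p.faces, (if maxFace p.1 y = q.1 then (1 : K) else 0) • Finsupp.single q 1 := by
  by_cases hne : (maxFace p.1 y).Nonempty
  · obtain ⟨q, hq⟩ : ∃ q : GP κ I, maxFace p.1 y = q.1 := ⟨⟨_, isGP_maxFace p.2 hne⟩, rfl⟩
    rw [GP.maxFaceVector_eq_single hq, Finset.sum_eq_single q, if_pos hq, one_smul]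
    · intro q' _ hne'
      rw [if_neg, zero_smul]
      exact fun h => hne' (Subtype.ext (h.symm.trans hq))
    · exact fun h => absurd (GP.mem_faces.mpr ⟨q.2.nonempty, y, hq.symm⟩) h
  · rw [GP.maxFaceVector_eq_zero hne]
    refine (Finset.sum_eq_zero fun q hq => ?_).symm
    rw [if_neg, zero_smul]
    exact fun h => hne (h ▸ (GP.mem_faces.mp hq).1)

/-- The antipode of the Hopf monoid of generalized permutahedra is the signed sum of the faces. -/
theorem antipode_single (p : GP κ I) :
    (gpOperations K κ).antipode I (Finsupp.single p 1) =
      (-1 : K) ^ I.card • ∑ q ∈ p.faces, (-1 : K) ^ dim q.1 • Finsupp.single q 1 := by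
  classical
  have h1 : (gpOperations K κ).antipode I (Finsupp.single p 1) =
      ∑ k ∈ Finset.range (I.card + 1), ∑ F ∈ compositions I k, ∑ q ∈ p.faces,
        (if maxFace p.1 (fun i => listDir (List.ofFn F) i) = q.1 then (-1 : K) ^ k else 0) •
          Finsupp.single q 1 := by
    rw [Operations.antipode, LinearMap.sum_apply]
    refine Finset.sum_congr rfl fun k _ => ?_
    rw [LinearMap.sum_apply]
    refine Finset.sum_congr rfl fun F hF => ?_
    simp only [compositions, Finset.mem_filter, Fintype.mem_piFinset, Finset.mem_powerset] at hF
    obtain ⟨hsub, hne, hdisj, hcov⟩ := hF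
    rw [LinearMap.smul_apply, mulComul_single, GP.maxFaceVector_eq_sum, Finset.smul_sum]
    · refine Finset.sum_congr rfl fun q _ => ?_
      rw [smul_smul, mul_ite, mul_one, mul_zero]
    · exact List.pairwise_ofFn.mpr fun i j hij => hdisj i j hij.ne
    · exact fun S hS => by
        obtain ⟨a, rfl⟩ := List.mem_ofFn.mp hS
        exact hsub a
    · exact fun x hx => by
        obtain ⟨a, ha⟩ := hcov x hx
        exact ⟨F a, List.mem_ofFn.mpr ⟨a, rfl⟩, ha⟩
  have h2 : ∀ k ∈ Finset.range (I.card + 1), ∑ F ∈ compositions I k, ∑ q ∈ p.faces,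
        (if maxFace p.1 (fun i => listDir (List.ofFn F) i) = q.1 then (-1 : K) ^ k else 0) •
          (Finsupp.single q 1 : GP κ I →₀ K) =
      ∑ q ∈ p.faces, ∑ F ∈ compositions I k,
        (if maxFace p.1 (fun i => listDir (List.ofFn F) i) = q.1 then (-1 : K) ^ k else 0) •
          Finsupp.single q 1 := fun k _ => Finset.sum_comm
  rw [h1, Finset.sum_congr rfl h2, Finset.sum_comm, Finset.smul_sum]
  refine Finset.sum_congr rfl fun q hq => ?_
  rw [smul_smul, ← sum_compositions_maxFace_eq p.2.ext (GP.mem_faces.mp hq), Finset.sum_smul]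
  exact Finset.sum_congr rfl fun k _ => (Finset.sum_smul).symm

end AntipodeFormula

/-! ### Normal equivalence through inclusions of maximum faces -/

section NormalEquivalence

variable {ι : Type*} [Fintype ι]

/-- The maximum face in direction `y` exists and is contained in the one in direction `z`. -/
def FaceLE (p : Set (ι → ℝ)) (y z : ι → ℝ) : Prop :=
  (maxFace p y).Nonempty ∧ maxFace p y ⊆ maxFace p z

lemma faceLE_self {p : Set (ι → ℝ)} {y : ι → ℝ} : FaceLE p y y ↔ (maxFace p y).Nonempty :=
  and_iff_left subset_rfl

lemma FaceLE.trans {p : Set (ι → ℝ)} {y z u : ι → ℝ} (h : FaceLE p y z) (h' : FaceLE p z u) :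
    FaceLE p y u := ⟨h.1, h.2.trans h'.2⟩

lemma FaceLE.self_right {p : Set (ι → ℝ)} {y z : ι → ℝ} (h : FaceLE p y z) : FaceLE p z z :=
  ⟨h.1.mono h.2, subset_rfl⟩

lemma mem_normalCone_maxFace {p : Set (ι → ℝ)} {y z : ι → ℝ} :
    z ∈ normalCone p (maxFace p y) ↔ FaceLE p y z := by
  constructor
  · rintro ⟨hne, w, hw⟩
    refine ⟨hne, ?_⟩
    rw [hw]
    exact fun _ h => h.1
  · exact fun h => ⟨h.1, y, (maxFace_maxFace h.1 h.2).symm⟩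

lemma mem_normalFan {p : Set (ι → ℝ)} {C : Set (ι → ℝ)} :
    C ∈ normalFan p ↔ ∃ y, FaceLE p y y ∧ C = {z | FaceLE p y z} := by
  have key : ∀ y, normalCone p (maxFace p y) = {z | FaceLE p y z} := fun y =>
    Set.ext fun z => mem_normalCone_maxFace
  constructor
  · rintro ⟨q, ⟨hne, y, rfl⟩, rfl⟩
    exact ⟨y, faceLE_self.mpr hne, key y⟩
  · rintro ⟨y, hy, rfl⟩
    exact ⟨_, ⟨hy.1, y, rfl⟩, (key y).symm⟩

/-- Normal equivalence in terms of the inclusions between maximum faces. -/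
lemma normallyEquiv_iff {p p' : Set (ι → ℝ)} :
    NormallyEquiv p p' ↔ ∀ y z, FaceLE p y z ↔ FaceLE p' y z := by
  constructor
  · have key : ∀ p p' : Set (ι → ℝ), normalFan p = normalFan p' → ∀ y z, FaceLE p y z →
        FaceLE p' y z := by
      intro p p' h y z hyz
      have hC : {z | FaceLE p y z} ∈ normalFan p :=
        mem_normalFan.mpr ⟨y, faceLE_self.mpr hyz.1, rfl⟩
      rw [h] at hC
      -- This exchange only shows that `p'` has a maximum face at `y`. The cone of `p'` there is
      -- then also a cone of `p`, at some `y''`. It contains `y`, hence by transitivity also `z`.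
      obtain ⟨y', -, hy'⟩ := mem_normalFan.mp hC
      have h1 : FaceLE p' y' y := hy'.subset (faceLE_self.mpr hyz.1)
      have hD : {z | FaceLE p' y z} ∈ normalFan p' := mem_normalFan.mpr ⟨y, h1.self_right, rfl⟩
      rw [← h] at hD
      obtain ⟨y'', -, hy''⟩ := mem_normalFan.mp hD
      have h2 : FaceLE p y'' y := hy''.subset h1.self_right
      exact hy''.symm.subset (h2.trans hyz)
    exact fun h y z => ⟨key p p' h y z, key p' p h.symm y z⟩
  · intro h
    refine Set.ext fun C => ?_
    simp only [mem_normalFan, h]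

/-- Faces in the same direction of normally equivalent polyhedra are normally equivalent. -/
lemma NormallyEquiv.maxFace {p p' : Set (ι → ℝ)} (hp : IsExtGenPerm p) (hp' : IsExtGenPerm p')
    (h : NormallyEquiv p p') (w : ι → ℝ) :
    NormallyEquiv (GenPerm.maxFace p w) (GenPerm.maxFace p' w) := by
  rw [normallyEquiv_iff] at h ⊢
  intro y z
  obtain ⟨ε, h1, h2, h3, h4⟩ := ((hp.eventually_maxFace_add_smul w y).and
    ((hp.eventually_maxFace_add_smul w z).and ((hp'.eventually_maxFace_add_smul w y).and
    (hp'.eventually_maxFace_add_smul w z)))).exists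
  have := h (w + ε • y) (w + ε • z)
  rwa [FaceLE, FaceLE, h1, h2, h3, h4] at this

lemma NormallyEquiv.nonempty_maxFace_iff {p p' : Set (ι → ℝ)} (h : NormallyEquiv p p')
    (w : ι → ℝ) : (GenPerm.maxFace p w).Nonempty ↔ (GenPerm.maxFace p' w).Nonempty := by
  rw [← faceLE_self, ← faceLE_self]
  exact normallyEquiv_iff.mp h w w

/-- The cone at the face in direction `0`, which is `p` itself, is the annihilator of the directions
of `p`. This makes the sign an invariant of the class. -/
lemma NormallyEquiv.dim_eq {p p' : Set (ι → ℝ)} (hp : p.Nonempty) (hp' : p'.Nonempty)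
    (h : NormallyEquiv p p') : dim p = dim p' := by
  classical
  have key : ∀ {q : Set (ι → ℝ)}, q.Nonempty → ∀ z,
      FaceLE q 0 z ↔ ∀ v ∈ vectorSpan ℝ q, z ⬝ᵥ v = 0 := fun {q} hq z => by
    rw [FaceLE, maxFace_zero, and_iff_right hq, subset_maxFace_iff]
  have e : (vectorSpan ℝ p).dualAnnihilator = (vectorSpan ℝ p').dualAnnihilator := by
    ext φ
    obtain ⟨z, rfl⟩ := (dotProductEquiv ℝ ι).surjective φ
    rw [Submodule.mem_dualAnnihilator, Submodule.mem_dualAnnihilator]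
    exact ((key hp z).symm.trans (normallyEquiv_iff.mp h 0 z)).trans (key hp' z)
  rw [dim, dim, Subspace.dualAnnihilator_inj.mp e]

omit [Fintype ι] in
lemma dim_perm (w : Equiv.Perm ι) (q : Set (ι → ℝ)) : dim (permAct w '' q) = dim q := by
  let e : (ι → ℝ) ≃ₗ[ℝ] (ι → ℝ) := LinearEquiv.funCongrLeft ℝ ℝ w.symm
  have := AffineMap.map_vectorSpan (k := ℝ) (s := q) e.toLinearMap.toAffineMap
  have h2 : vectorSpan ℝ (permAct w '' q) = (vectorSpan ℝ q).map e.toLinearMap := this.symm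
  rw [dim, dim, h2]
  exact LinearEquiv.finrank_map_eq e _

lemma isPolyhedron_perm {p : Set (ι → ℝ)} (hp : IsPolyhedron p) (w : Equiv.Perm ι) :
    IsPolyhedron (permAct w '' p) := by
  classical
  obtain ⟨H, rfl⟩ := hp
  refine ⟨H.image fun h => (permAct w h.1, h.2), ?_⟩
  ext x
  obtain ⟨x, rfl⟩ := permAct_surj w x
  rw [(permAct_inj w).mem_set_image]
  simp only [Set.mem_ofPred_eq, Finset.forall_mem_image, permAct_dotProduct]

lemma isExtGenPerm_perm {p : Set (ι → ℝ)} (hp : IsExtGenPerm p) (w : Equiv.Perm ι) :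
    IsExtGenPerm (permAct w '' p) := by
  refine isExtGenPerm_iff.mpr ⟨isPolyhedron_perm hp.1 w, hp.2.1.image _, fun y z hz => ?_⟩
  obtain ⟨y, rfl⟩ := permAct_surj w y
  obtain ⟨z, rfl⟩ := permAct_surj w z
  rw [maxFace_perm, maxFace_perm]
  refine Set.image_mono (hp.maxFace_subset fun i j hij => ?_)
  simpa [permAct] using hz (w i) (w j) (by simpa [permAct] using hij)

lemma isGP_perm {κ : Kind} {p : Set (ι → ℝ)} (hp : IsGP κ p) (w : Equiv.Perm ι) :
    IsGP κ (permAct w '' p) := by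
  cases κ
  · have hp' := isGenPerm_iff.mp hp
    refine isGenPerm_iff.mpr ⟨isExtGenPerm_perm hp'.1 w, fun y => ?_⟩
    obtain ⟨y, rfl⟩ := permAct_surj w y
    rw [maxFace_perm]
    exact (hp'.2 y).image _
  · exact isExtGenPerm_perm hp w

end NormalEquivalence

/-! ### Passage to normal and quasinormal equivalence classes -/

section Quotients

variable {α : Type*} [DecidableEq α] {κ : Kind} {S I : Finset α} (h : S ⊆ I)

lemma faceLE_prodSet {r : Set (S → ℝ)} {c : Set (↥(I \ S) → ℝ)} {y z : I → ℝ} :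
    FaceLE (prodSet h r c) y z ↔
      FaceLE r (Finset.restrict₂ (π := fun _ => ℝ) h y) (Finset.restrict₂ (π := fun _ => ℝ) h z) ∧
      FaceLE c (Finset.restrict₂ (π := fun _ => ℝ) Finset.sdiff_subset y)
        (Finset.restrict₂ (π := fun _ => ℝ) Finset.sdiff_subset z) := by
  rw [FaceLE, maxFace_prodSet, maxFace_prodSet]
  constructor
  · rintro ⟨hne, hsub⟩
    obtain ⟨h1, h2⟩ := nonempty_of_prodSet_nonempty h hne
    obtain ⟨h3, h4⟩ := subset_of_prodSet_subset h hsub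
    exact ⟨⟨h1, h3 h2⟩, h2, h4 h1⟩
  · rintro ⟨⟨h1, h3⟩, h2, h4⟩
    exact ⟨prodSet_nonempty h h1 h2, prodSet_mono h h3 h4⟩

lemma faceLE_zero {ι : Type*} [Fintype ι] {q : Set (ι → ℝ)} (hq : q.Nonempty) : FaceLE q 0 0 := by
  rwa [faceLE_self, maxFace_zero]

/-- One implication makes the product of classes well defined; the other, through directions
extended by zero, makes the coproduct well defined. -/
lemma normallyEquiv_prodSet_iff {r r' : Set (S → ℝ)} {c c' : Set (↥(I \ S) → ℝ)}
    (hr : r.Nonempty) (hr' : r'.Nonempty) (hc : c.Nonempty) (hc' : c'.Nonempty) :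
    NormallyEquiv (prodSet h r c) (prodSet h r' c') ↔ NormallyEquiv r r' ∧ NormallyEquiv c c' := by
  simp only [normallyEquiv_iff, faceLE_prodSet]
  constructor
  · intro hyz
    refine ⟨fun y z => ?_, fun y z => ?_⟩
    · have := hyz (glue S I y 0) (glue S I z 0)
      simpa only [restrict_glue_left, restrict_glue_right, faceLE_zero hc, faceLE_zero hc',
        and_true] using this
    · have := hyz (glue S I 0 y) (glue S I 0 z)
      simpa only [restrict_glue_left, restrict_glue_right, faceLE_zero hr, faceLE_zero hr',
        true_and] using this
  · exact fun ⟨h1, h2⟩ y z => and_congr (h1 _ _) (h2 _ _)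

variable (K : Type*) [Field K]

omit [DecidableEq α] in
lemma proj_single (s : Setoid (GP κ I)) (p : GP κ I) :
    proj K s (Finsupp.single p 1) = Finsupp.single (Quotient.mk s p) 1 :=
  Finsupp.mapDomain_single

omit [DecidableEq α] in
lemma proj_surjective (s : Setoid (GP κ I)) : Function.Surjective (proj K s) :=
  Finsupp.mapDomain_surjective Quotient.mk_surjective

/-- The maximum faces in the direction `𝟙_S` are empty together or normally equivalent, and in the
latter case so are their factors. -/
lemma map_proj_coproduct_eq {p p' : GP κ I} (hpp : NormallyEquiv p.1 p'.1) :
    TensorProduct.map (proj K (normalSetoid κ S)) (proj K (normalSetoid κ (I \ S)))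
        (GP.coproduct K h p) =
      TensorProduct.map (proj K (normalSetoid κ S)) (proj K (normalSetoid κ (I \ S)))
        (GP.coproduct K h p') := by
  have hiff := hpp.nonempty_maxFace_iff (indicatorDir S I)
  by_cases hne : (maxFace p.1 (indicatorDir S I)).Nonempty
  · obtain ⟨⟨r, c⟩, hrc⟩ := p.exists_isMinors h hne
    obtain ⟨⟨r', c'⟩, hrc'⟩ := p'.exists_isMinors h (hiff.mp hne)
    have heq := hpp.maxFace p.2.ext p'.2.ext (indicatorDir S I)
    have e1 : maxFace p.1 (indicatorDir S I) = prodSet h r.1 c.1 := hrc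
    have e2 : maxFace p'.1 (indicatorDir S I) = prodSet h r'.1 c'.1 := hrc'
    rw [e1, e2, normallyEquiv_prodSet_iff h r.2.nonempty r'.2.nonempty c.2.nonempty
      c'.2.nonempty] at heq
    rw [hrc.coproduct_eq K, hrc'.coproduct_eq K, TensorProduct.map_tmul, TensorProduct.map_tmul,
      proj_single, proj_single, proj_single, proj_single]
    congr 2
    · exact Quotient.sound heq.1
    · exact Quotient.sound heq.2
  · rw [GP.coproduct_eq_zero K hne, GP.coproduct_eq_zero K (mt hiff.mpr hne)]

/-- The operations induced on the normal equivalence classes. -/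
def normalOperations (κ : Kind) :
    Operations K (fun I : Finset α => Quotient (normalSetoid κ I) →₀ K) where
  mul {S I} h := TensorProduct.lift <|
    Finsupp.linearCombination K fun a => Finsupp.linearCombination K fun b =>
      Finsupp.single (Quotient.map₂ (sa := normalSetoid κ S) (sb := normalSetoid κ (I \ S))
        (sc := normalSetoid κ I) (GP.prod h) (fun r r' hr c c' hc =>
        (normallyEquiv_prodSet_iff h r.2.nonempty r'.2.nonempty c.2.nonempty c'.2.nonempty).mpr
          ⟨hr, hc⟩) a b) 1
  comul {S I} h := Finsupp.linearCombination K <|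
    Quotient.lift (fun p => TensorProduct.map (proj K (normalSetoid κ S))
      (proj K (normalSetoid κ (I \ S))) (GP.coproduct K h p))
      fun _ _ hpp => map_proj_coproduct_eq h K hpp

lemma isMorphism_proj (κ : Kind) : IsMorphism (gpOperations K κ) (normalOperations (α := α) K κ)
    (fun I => proj K (normalSetoid κ I)) := by
  refine fun S I h => ⟨?_, ?_⟩
  · refine TensorProduct.ext (Finsupp.lhom_ext' fun r => LinearMap.ext_ring
      (Finsupp.lhom_ext' fun c => LinearMap.ext_ring ?_))
    change proj K (normalSetoid κ I) ((gpOperations K κ).mul h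
      (Finsupp.single r 1 ⊗ₜ[K] Finsupp.single c 1)) = (normalOperations K κ).mul h
      (proj K (normalSetoid κ S) (Finsupp.single r 1) ⊗ₜ[K]
        proj K (normalSetoid κ (I \ S)) (Finsupp.single c 1))
    rw [gpOperations_mul_single, proj_single, proj_single, proj_single]
    simp only [normalOperations, TensorProduct.lift.tmul, Finsupp.linearCombination_single, one_smul]
    rfl
  · refine Finsupp.lhom_ext' fun p => LinearMap.ext_ring ?_
    change TensorProduct.map (proj K (normalSetoid κ S)) (proj K (normalSetoid κ (I \ S)))
      ((gpOperations K κ).comul h (Finsupp.single p 1)) = (normalOperations K κ).comul h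
      (proj K (normalSetoid κ I) (Finsupp.single p 1))
    rw [gpOperations_comul_single, proj_single]
    simp [normalOperations]

variable {K}

lemma IsMorphism.eq_of_surjective {H H' : Finset α → Type*} [∀ I, AddCommGroup (H I)]
    [∀ I, Module K (H I)] [∀ I, AddCommGroup (H' I)] [∀ I, Module K (H' I)] {X : Operations K H}
    {Y Z : Operations K H'} {f : ∀ I, H I →ₗ[K] H' I} (hf : ∀ I, Function.Surjective (f I))
    (hY : IsMorphism X Y f) (hZ : IsMorphism X Z f) : Y = Z := by
  have hmul : @Y.mul = @Z.mul := by
    funext S I h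
    rw [← LinearMap.cancel_right (TensorProduct.map_surjective (hf S) (hf (I \ S))),
      ← (hY S I h).1, (hZ S I h).1]
  have hcomul : @Y.comul = @Z.comul := by
    funext S I h
    rw [← LinearMap.cancel_right (hf I), ← (hY S I h).2, (hZ S I h).2]
  cases Y
  cases Z
  congr

lemma IsMorphism.comp_mulComul {H H' : Finset α → Type*} [∀ I, AddCommGroup (H I)]
    [∀ I, Module K (H I)] [∀ I, AddCommGroup (H' I)] [∀ I, Module K (H' I)] {X : Operations K H}
    {Y : Operations K H'} {f : ∀ I, H I →ₗ[K] H' I} (hf : IsMorphism X Y f)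
    (L : List (Finset α)) (I : Finset α) :
    f I ∘ₗ X.mulComul L I = Y.mulComul L I ∘ₗ f I := by
  induction L generalizing I with
  | nil => rfl
  | cons S L ih =>
    cases L with
    | nil => rfl
    | cons S' L =>
      by_cases h : S ⊆ I
      · rw [Operations.mulComul, Operations.mulComul, dif_pos h, dif_pos h, ← LinearMap.comp_assoc,
          (hf S I h).1, LinearMap.comp_assoc, LinearMap.comp_assoc, LinearMap.comp_assoc,
          ← (hf S I h).2]
        have e : TensorProduct.map (f S) (f (I \ S)) ∘ₗ
            TensorProduct.map LinearMap.id (X.mulComul (S' :: L) (I \ S)) =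
            TensorProduct.map LinearMap.id (Y.mulComul (S' :: L) (I \ S)) ∘ₗ
              TensorProduct.map (f S) (f (I \ S)) := by
          rw [← TensorProduct.map_comp, ← TensorProduct.map_comp, ih, LinearMap.id_comp,
            LinearMap.comp_id]
        exact LinearMap.ext fun x => congrArg (Y.mul h) (LinearMap.congr_fun e (X.comul h x))
      · rw [Operations.mulComul, Operations.mulComul, dif_neg h, dif_neg h, LinearMap.comp_zero,
          LinearMap.zero_comp]

/-- The antipode is a fixed expression in products and coproducts, so preserving these is enough. -/
lemma IsMorphism.map_antipode {H H' : Finset α → Type*} [∀ I, AddCommGroup (H I)]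
    [∀ I, Module K (H I)] [∀ I, AddCommGroup (H' I)] [∀ I, Module K (H' I)] {X : Operations K H}
    {Y : Operations K H'} {f : ∀ I, H I →ₗ[K] H' I} (hf : IsMorphism X Y f) (I : Finset α)
    (x : H I) : f I (X.antipode I x) = Y.antipode I (f I x) := by
  simp only [Operations.antipode, LinearMap.sum_apply, map_sum, LinearMap.smul_apply, map_smul]
  refine Finset.sum_congr rfl fun k _ => Finset.sum_congr rfl fun F _ => ?_
  congr 1
  exact LinearMap.congr_fun (hf.comp_mulComul _ I) x

omit [DecidableEq α] in
lemma proj_signed_sum (s : Setoid (GP κ I)) (p : GP κ I) :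
    proj K s ((-1 : K) ^ I.card • ∑ q ∈ p.faces, (-1 : K) ^ dim q.1 • Finsupp.single q 1) =
      (-1 : K) ^ I.card • ∑ q ∈ p.faces, (-1 : K) ^ dim q.1 •
        Finsupp.single (Quotient.mk s q) 1 := by
  simp only [map_smul, map_sum, proj_single]

/-- The image of a generalized permutahedron under a permutation of the coordinates. -/
def GP.perm (w : Equiv.Perm I) (p : GP κ I) : GP κ I := ⟨permAct w '' p.1, isGP_perm p.2 w⟩

omit [DecidableEq α] in
lemma GP.perm_inv_perm (w : Equiv.Perm I) (p : GP κ I) : (p.perm w).perm w⁻¹ = p :=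
  Subtype.ext (image_perm_cancel w p.1)

omit [DecidableEq α] in
lemma GP.sum_faces_perm {M : Type*} [AddCommMonoid M] (w : Equiv.Perm I) (p : GP κ I)
    (g : GP κ I → M) : ∑ q ∈ (p.perm w).faces, g q = ∑ q ∈ p.faces, g (q.perm w) := by
  symm
  refine Finset.sum_nbij' (GP.perm w) (GP.perm w⁻¹) ?_ ?_ ?_ ?_ fun _ _ => rfl
  · exact fun q hq => GP.mem_faces.mpr ((GP.mem_faces.mp hq).perm w)
  · intro q hq
    have := (GP.mem_faces.mp hq).perm w⁻¹
    refine GP.mem_faces.mpr ?_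
    have e : permAct w⁻¹ '' (p.perm w).1 = p.1 := image_perm_cancel w p.1
    rwa [e] at this
  · exact fun q _ => GP.perm_inv_perm w q
  · intro q _
    have := GP.perm_inv_perm w⁻¹ q
    rwa [inv_inv] at this

lemma proj_normal_antipode_eq {p p' : GP κ I} (hpp : NormallyEquiv p.1 p'.1) :
    proj K (normalSetoid κ I) ((gpOperations K κ).antipode I (Finsupp.single p 1)) =
      proj K (normalSetoid κ I) ((gpOperations K κ).antipode I (Finsupp.single p' 1)) := by
  have key := (isMorphism_proj K κ).map_antipode I
  have e : Quotient.mk (normalSetoid κ I) p = Quotient.mk (normalSetoid κ I) p' :=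
    Quotient.sound hpp
  refine (key _).trans (Eq.trans ?_ (key _).symm)
  rw [proj_single, proj_single, e]

omit [DecidableEq α] in
lemma quasinormallyEquiv_of_normallyEquiv {p p' : GP κ I} (hpp : NormallyEquiv p.1 p'.1) :
    QuasinormallyEquiv p.1 p'.1 := by
  refine ⟨1, ?_⟩
  have e : permAct (1 : Equiv.Perm I) '' p'.1 = p'.1 :=
    (congrArg (· '' p'.1) (funext permAct_one)).trans (Set.image_id _)
  rwa [e]

/-- Normal equivalence is dealt with because the projection factors through normal classes. For the
remaining permutation the explicit formula is compared term by term: faces correspond, with equal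
dimensions and equal classes. -/
lemma proj_quasinormal_antipode_eq {p p' : GP κ I} (hpp : QuasinormallyEquiv p.1 p'.1) :
    proj K (quasinormalSetoid κ I) ((gpOperations K κ).antipode I (Finsupp.single p 1)) =
      proj K (quasinormalSetoid κ I) ((gpOperations K κ).antipode I (Finsupp.single p' 1)) := by
  obtain ⟨w, hw⟩ := hpp
  let φ : Quotient (normalSetoid κ I) → Quotient (quasinormalSetoid κ I) :=
    Quotient.map id fun _ _ h => quasinormallyEquiv_of_normallyEquiv h
  have hφ : ∀ x, proj K (quasinormalSetoid κ I) x =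
      Finsupp.lmapDomain K K φ (proj K (normalSetoid κ I) x) := by
    have e : proj K (quasinormalSetoid κ I) =
        Finsupp.lmapDomain K K φ ∘ₗ proj K (normalSetoid κ I) := by
      rw [proj, proj, ← Finsupp.lmapDomain_comp]
      rfl
    exact fun x => LinearMap.congr_fun e x
  have h1 : NormallyEquiv p.1 (p'.perm w).1 := hw
  rw [hφ, proj_normal_antipode_eq h1, ← hφ, antipode_single, antipode_single, proj_signed_sum,
    proj_signed_sum, GP.sum_faces_perm]
  congr 1
  refine Finset.sum_congr rfl fun q _ => ?_
  have e1 : dim (q.perm w).1 = dim q.1 := dim_perm w q.1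
  have e2 : Quotient.mk (quasinormalSetoid κ I) (q.perm w) = Quotient.mk _ q :=
    Quotient.sound ⟨w, rfl⟩
  rw [e1, e2]

omit [DecidableEq α] in
lemma QuasinormallyEquiv.dim_eq {p p' : GP κ I} (hpp : QuasinormallyEquiv p.1 p'.1) :
    dim p.1 = dim p'.1 := by
  obtain ⟨w, hw⟩ := hpp
  rw [NormallyEquiv.dim_eq p.2.nonempty (p'.2.nonempty.image _) hw, dim_perm]

end Quotients

end GenPerm

end

/-! ### The main theorem -/

theorem theorem6p1 {K : Type*} [Field K] [CharZero K] {α : Type*} [DecidableEq α]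
    (κ : GenPerm.Kind) :
    -- the sums below run over all the nonempty faces
    (∀ (I : Finset α) (p : GenPerm.GP κ I) (F : Set (I → ℝ)),
      GenPerm.IsFace F p.1 ↔ ∃ q ∈ p.faces, q.1 = F) ∧
    -- the antipode of the Hopf monoid
    (∀ (I : Finset α) (p : GenPerm.GP κ I),
      (GenPerm.gpOperations K κ).antipode I (Finsupp.single p 1) =
        (-1 : K) ^ I.card • ∑ q ∈ p.faces, (-1 : K) ^ GenPerm.dim q.1 • Finsupp.single q 1) ∧
    -- this formula is cancellation-free and grouping-free
    (∀ (I : Finset α) (p : GenPerm.GP κ I),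
      GenPerm.CancellationFree p.faces
        (fun q => (-1 : K) ^ I.card * (-1 : K) ^ GenPerm.dim q.1)
        (fun q => (Finsupp.single q 1 : GenPerm.GP κ I →₀ K)) ∧
      GenPerm.GroupingFree p.faces (fun q => (Finsupp.single q 1 : GenPerm.GP κ I →₀ K)) ∧
      ∀ q : GenPerm.GP κ I, (q ∈ p.faces →
          (GenPerm.gpOperations K κ).antipode I (Finsupp.single p 1) q =
            (-1 : K) ^ I.card * (-1 : K) ^ GenPerm.dim q.1) ∧
        (q ∉ p.faces → (GenPerm.gpOperations K κ).antipode I (Finsupp.single p 1) q = 0)) ∧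
    -- the quotient by normal equivalence: the operations descend, and the antipode is given by
    -- the same formula, which is cancellation-free
    (∃ X : GenPerm.Operations K
        (fun I : Finset α => Quotient (GenPerm.normalSetoid κ I) →₀ K),
      GenPerm.IsMorphism (GenPerm.gpOperations K κ) X
        (fun I => GenPerm.proj K (GenPerm.normalSetoid κ I)) ∧
      (∀ X', GenPerm.IsMorphism (GenPerm.gpOperations K κ) X'
        (fun I => GenPerm.proj K (GenPerm.normalSetoid κ I)) → X' = X) ∧
      ∀ (I : Finset α) (p : GenPerm.GP κ I),
        X.antipode I (Finsupp.single (Quotient.mk (GenPerm.normalSetoid κ I) p) 1) =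
          (-1 : K) ^ I.card • ∑ q ∈ p.faces, (-1 : K) ^ GenPerm.dim q.1 •
            Finsupp.single (Quotient.mk (GenPerm.normalSetoid κ I) q) 1) ∧
    (∀ (I : Finset α) (p : GenPerm.GP κ I),
      GenPerm.CancellationFree p.faces
        (fun q => (-1 : K) ^ I.card * (-1 : K) ^ GenPerm.dim q.1)
        (fun q => (Finsupp.single (Quotient.mk (GenPerm.normalSetoid κ I) q) 1 :
          Quotient (GenPerm.normalSetoid κ I) →₀ K))) ∧
    -- the quotient by quasinormal equivalence: the antipode descends, and is given by the same
    -- formula, which is cancellation-free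
    (∀ I : Finset α, ∃ s : (Quotient (GenPerm.quasinormalSetoid κ I) →₀ K) →ₗ[K]
        (Quotient (GenPerm.quasinormalSetoid κ I) →₀ K),
      s ∘ₗ GenPerm.proj K (GenPerm.quasinormalSetoid κ I) =
        GenPerm.proj K (GenPerm.quasinormalSetoid κ I) ∘ₗ
          (GenPerm.gpOperations K κ).antipode I ∧
      (∀ s', s' ∘ₗ GenPerm.proj K (GenPerm.quasinormalSetoid κ I) =
        GenPerm.proj K (GenPerm.quasinormalSetoid κ I) ∘ₗ
          (GenPerm.gpOperations K κ).antipode I → s' = s) ∧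
      ∀ p : GenPerm.GP κ I,
        s (Finsupp.single (Quotient.mk (GenPerm.quasinormalSetoid κ I) p) 1) =
          (-1 : K) ^ I.card • ∑ q ∈ p.faces, (-1 : K) ^ GenPerm.dim q.1 •
            Finsupp.single (Quotient.mk (GenPerm.quasinormalSetoid κ I) q) 1) ∧
    (∀ (I : Finset α) (p : GenPerm.GP κ I),
      GenPerm.CancellationFree p.faces
        (fun q => (-1 : K) ^ I.card * (-1 : K) ^ GenPerm.dim q.1)
        (fun q => (Finsupp.single (Quotient.mk (GenPerm.quasinormalSetoid κ I) q) 1 :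
          Quotient (GenPerm.quasinormalSetoid κ I) →₀ K))) := by

  refine ⟨?_, fun I p => GenPerm.antipode_single p, ?_, ?_, ?_, ?_, ?_⟩
  · intro I p F
    constructor
    · exact fun hF => ⟨⟨F, GenPerm.isGP_of_isFace p.2 hF⟩, GenPerm.GP.mem_faces.mpr hF, rfl⟩
    · rintro ⟨q, hq, rfl⟩
      exact GenPerm.GP.mem_faces.mp hq
  · intro I p
    have hinj : Function.Injective
        fun q => (Finsupp.single q 1 : GenPerm.GP κ I →₀ K) :=
      Finsupp.single_left_injective one_ne_zero
    refine ⟨fun q _ q' _ h => by rw [hinj h], fun q _ q' _ h => hinj h, fun q => ?_⟩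
    classical
    have hcoeff : (GenPerm.gpOperations K κ).antipode I (Finsupp.single p 1) q =
        if q ∈ p.faces then (-1 : K) ^ I.card * (-1 : K) ^ GenPerm.dim q.1 else 0 := by
      rw [GenPerm.antipode_single, Finsupp.smul_apply, Finsupp.finsetSum_apply]
      simp [Finsupp.single_apply]
    exact ⟨fun hq => by rw [hcoeff, if_pos hq], fun hq => by rw [hcoeff, if_neg hq]⟩
  · refine ⟨GenPerm.normalOperations K κ, GenPerm.isMorphism_proj K κ, fun X' hX' =>
      hX'.eq_of_surjective (fun I => GenPerm.proj_surjective K _) (GenPerm.isMorphism_proj K κ),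
      fun I p => ?_⟩
    -- Both sides are lifted along the projection, which commutes with the antipodes.
    rw [← GenPerm.proj_single, ← GenPerm.proj_signed_sum, ← GenPerm.antipode_single]
    exact ((GenPerm.isMorphism_proj K κ).map_antipode I _).symm
  · intro I p q _ q' _ h
    have e : GenPerm.dim q.1 = GenPerm.dim q'.1 :=
      GenPerm.NormallyEquiv.dim_eq q.2.nonempty q'.2.nonempty
        (Quotient.exact (Finsupp.single_left_injective one_ne_zero h))
    dsimp only
    rw [e]
  · intro I
    have hs : ∀ p : GenPerm.GP κ I, Finsupp.linearCombination K
        (Quotient.lift (s := GenPerm.quasinormalSetoid κ I)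
          (fun p => GenPerm.proj K (GenPerm.quasinormalSetoid κ I)
            ((GenPerm.gpOperations K κ).antipode I (Finsupp.single p 1)))
          fun _ _ h => GenPerm.proj_quasinormal_antipode_eq h)
        (Finsupp.single (Quotient.mk (GenPerm.quasinormalSetoid κ I) p) 1) =
        GenPerm.proj K (GenPerm.quasinormalSetoid κ I)
          ((GenPerm.gpOperations K κ).antipode I (Finsupp.single p 1)) := fun p => by
      rw [Finsupp.linearCombination_single, one_smul, Quotient.lift_mk]
    have hcomp : Finsupp.linearCombination K
        (Quotient.lift (s := GenPerm.quasinormalSetoid κ I)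
          (fun p => GenPerm.proj K (GenPerm.quasinormalSetoid κ I)
            ((GenPerm.gpOperations K κ).antipode I (Finsupp.single p 1)))
          fun _ _ h => GenPerm.proj_quasinormal_antipode_eq h) ∘ₗ
          GenPerm.proj K (GenPerm.quasinormalSetoid κ I) =
        GenPerm.proj K (GenPerm.quasinormalSetoid κ I) ∘ₗ
          (GenPerm.gpOperations K κ).antipode I :=
      Finsupp.lhom_ext' fun p => LinearMap.ext_ring <| by
        change Finsupp.linearCombination K _ (GenPerm.proj K _ (Finsupp.single p 1)) = _
        rw [GenPerm.proj_single, hs]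
        rfl
    refine ⟨_, hcomp, fun s' h' => ?_, fun p => ?_⟩
    -- Uniqueness holds because the projection is surjective.
    · rw [← LinearMap.cancel_right (GenPerm.proj_surjective K (GenPerm.quasinormalSetoid κ I)), h',
        hcomp]
    · rw [hs, GenPerm.antipode_single, GenPerm.proj_signed_sum]
  · intro I p q _ q' _ h
    have e : GenPerm.dim q.1 = GenPerm.dim q'.1 :=
      GenPerm.QuasinormallyEquiv.dim_eq
        (Quotient.exact (Finsupp.single_left_injective one_ne_zero h))
    dsimp only
    rw [e]
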